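/- Let $\Omega=\mathbb R\times\mathbb T$ with $\mathbb T=\mathbb R/\mathbb Z$, let $x=(x_1,x_2)$ denote the points of $\Omega$, and set $V(t)=\min(t,\sqrt t)$ for $t>0$. For every $1\le p\le q\le\infty$ there exists a constant $K_1>0$, depending only on $p$ and $q$, with the following property. Let $u=(u_1,u_2):\Omega\times(0,\infty)\to\mathbb R^2$ be a smooth divergence-free vector field such that $u_1$ is bounded on $\Omega\times(0,T]$ for every $T>0$. Let $\omega_0\in L^p(\Omega)$, and let $\omega$ be a solution of $$\partial_t\omega+u\cdot\nabla\omega=\Delta\omega ,\qquad x\in\Omega,\ t>0,$$ with initial data $\omega_0$. Then $$\|\omega(t)\|_{L^q(\Omega)}\le\frac{K_1}{V(t)^{\frac1p-\frac1q}}\,\|\omega_0\|_{L^p(\Omega)}\qquad\text{for all } t>0 .$$ Here a solution with initial data $\omega_0$ is a real-valued function $\omega$ on $\Omega\times(0,\infty)$ that is $C^1$ in $(x,t)$ and $C^2$ in $x$ for each fixed $t$, satisfies the equation pointwise, satisfies $\sup_{0<t\le T}\,\sup_{a\in\mathbb R}\int_{[a,a+1]\times\mathbb T}|\omega(x,t)|\,dx<\infty$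 for every $T>0$, and converges to $\omega_0$ in $L^1_{\mathrm{loc}}(\Omega)$, that is, $\int_{[-R,R]\times\mathbb T}|\omega(x,t)-\omega_0(x)|\,dx\to0$ as $t\to0^+$ for every $R>0$. -/

import Mathlib

open MeasureTheory Filter Topology Set
open scoped ENNReal NNReal ContDiff

namespace CylinderFlow

/-- The cylinder `Ω = ℝ × 𝕋` with `𝕋 = ℝ / ℤ`; its `volume` is the product of Lebesgue measure
and the Haar measure of total mass one. -/
abbrev Cylinder : Type := ℝ × UnitAddCircle

/-- The `x₂`-periodic lift to `(t, x₁, x₂) ∈ ℝ × ℝ × ℝ` of a time-dependent function on `Ω`. -/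
def lift {E : Type*} (f : ℝ → Cylinder → E) : ℝ × ℝ × ℝ → E :=
  fun z => f z.1 (z.2.1, (z.2.2 : UnitAddCircle))

/-- The `x₂`-periodic lift to `(x₁, x₂) ∈ ℝ × ℝ` of a function on `Ω`. -/
def spaceLift {E : Type*} (f : Cylinder → E) : ℝ × ℝ → E :=
  fun y => f (y.1, (y.2 : UnitAddCircle))

/-- The horizontal partial derivative `∂₁ f` of a function on `Ω`. -/
noncomputable def d1 (f : Cylinder → ℝ) (x : Cylinder) : ℝ :=
  deriv (fun s : ℝ => f (x.1 + s, x.2)) 0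

/-- The vertical partial derivative `∂₂ f` of a function on `Ω`. -/
noncomputable def d2 (f : Cylinder → ℝ) (x : Cylinder) : ℝ :=
  deriv (fun s : ℝ => f (x.1, x.2 + (s : UnitAddCircle))) 0

/-- The Laplacian `Δ f = ∂₁² f + ∂₂² f` on `Ω`. -/
noncomputable def laplacian (f : Cylinder → ℝ) (x : Cylinder) : ℝ :=
  d1 (d1 f) x + d2 (d2 f) x

/-- The admissible drifts: vector fields on `Ω × (0, ∞)` that are smooth and divergence-free,
with a horizontal component that is bounded on `Ω × (0, T]` for every `T`. -/
structure IsDrift (u : ℝ → Cylinder → ℝ × ℝ) : Prop where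
  smooth : ContDiffOn ℝ ∞ (lift u) {z | 0 < z.1}
  div_free : ∀ t : ℝ, 0 < t → ∀ x : Cylinder,
    d1 (fun y => (u t y).1) x + d2 (fun y => (u t y).2) x = 0
  horizontal_bounded : ∀ T : ℝ, 0 < T → ∃ M : ℝ, ∀ t ∈ Ioc 0 T, ∀ x : Cylinder,
    |(u t x).1| ≤ M

/-- `w` is a solution of `∂ₜ w + u · ∇w = Δw` on `Ω × (0, ∞)` with initial data `w₀`: it is a
classical solution for `t > 0`, it is bounded in the uniformly local space `L¹_uloc(Ω)` on bounded
time intervals (this holds if it is bounded there in `L^r(Ω)` for some `r ∈ [1, ∞]`; some such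
condition is needed to exclude the solutions with rapid growth in space that make the Cauchy
problem ill-posed), and `w(t) → w₀` in `L¹_loc(Ω)` as `t → 0+`. -/
structure IsSolution (u : ℝ → Cylinder → ℝ × ℝ) (w₀ : Cylinder → ℝ) (w : ℝ → Cylinder → ℝ) :
    Prop where
  contDiffOn : ContDiffOn ℝ 1 (lift w) {z | 0 < z.1}
  contDiff_space : ∀ t : ℝ, 0 < t → ContDiff ℝ 2 (spaceLift (w t))
  equation : ∀ t : ℝ, 0 < t → ∀ x : Cylinder,
    deriv (fun s => w s x) t + ((u t x).1 * d1 (w t) x + (u t x).2 * d2 (w t) x)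
      = laplacian (w t) x
  uloc_bounded : ∀ T : ℝ, 0 < T → ∃ C : ℝ≥0, ∀ t ∈ Ioc 0 T, ∀ a : ℝ,
    ∫⁻ x in Icc a (a + 1) ×ˢ (univ : Set UnitAddCircle), ‖w t x‖ₑ ≤ C
  initial : ∀ R : ℝ, 0 < R →
    Tendsto (fun t => ∫⁻ x in Icc (-R) R ×ˢ (univ : Set UnitAddCircle), ‖w t x - w₀ x‖ₑ)
      (𝓝[>] 0) (𝓝 0)

/-- `V(t) = min(t, √t)`. -/
noncomputable def V (t : ℝ) : ℝ := min t (Real.sqrt t)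

end CylinderFlow

/-! The drift disappears from every energy estimate because it is divergence-free, so the constants
are those of the heat equation on the cylinder. The proof is a De Giorgi iteration on the truncated
masses `∫ (ω - k)₊`, carried out on the strip `ℝ × [0, 1]` with periodicity in the second variable.

For a convex `C²` regularization `profile` of the positive part, testing the equation with a cutoff
in `x₁` alone leaves an error involving only `u₁` and derivatives of the cutoff, of size `1/L` times
the mass in `[-L, L] × [0, 1]`. The uniformly local `L¹` bound makes that mass `O(L)`, so the error
is bounded and a finite initial energy stays finite; with this knowledge the error tends to zero as
`L → ∞`. This gives `StripSolution.energy_inequality`. Rescaling `profile` and using affine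
invariance, every mass `∫ (ω - k)₊` is nonincreasing in time (when initially finite).

The dissipation supplies a quadratic gain (`StripSolution.level_gain`): `∫ (ω(t) - k - N)₊ ≤ 453 /
(N V(t - s)) (∫ (ω(s) - k)₊)²`. It comes from the inequality `∫ g² ≤ (∫|g| + ∫|∂₂g|) ∫|∂₁g|` for a
function `g` comparable to the square root of the truncated solution where that is large. The term
`∫|∂₂g|` accounts for the two-dimensional rate `1/t` at short times, the term `∫|g|` for the
one-dimensional rate `1/√t` at long times; together they produce `V`.

Iterating along geometric times and levels gives an upper bound `k + 14496 a / V(t)` when `∫ (ω₀ -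
k)₊ ≤ a` (`StripSolution.ae_le_level_add`). For data in `L^p`, Chebyshev's inequality at the level
`k = ‖ω₀‖_p / V^{1/p}` gives `a = k V`, hence the `L^p`–`L^∞` bound with constant 14497. The
layer-cake formula turns monotonicity at every level into contraction in `L^p`, and interpolation
gives all `q ≥ p`. -/

namespace CylinderFlow

/-! ### A convex truncation profile -/

/-- The auxiliary variable `√(1 + x₊)`. -/
noncomputable def rad (x : ℝ) : ℝ := √(1 + max x 0)

/-- A convex, nondecreasing, 1-Lipschitz `C²` function that vanishes on `(-∞, 0]` and behaves like
`x` at infinity. -/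
noncomputable def profile (x : ℝ) : ℝ := (rad x - 1) ^ 3 / rad x

/-- The derivative of `profile`. -/
noncomputable def profile' (x : ℝ) : ℝ := 1 - 3 / (2 * rad x) + 1 / (2 * rad x ^ 3)

/-- The second derivative of `profile`. -/
noncomputable def profile'' (x : ℝ) : ℝ := 3 / 4 * (max x 0) / rad x ^ 5

/-- A `C¹` function that vanishes on `(-∞, 0]` and behaves like `√x` at infinity. -/
noncomputable def rootProfile (x : ℝ) : ℝ := (rad x - 1) ^ 2 / rad x

/-- The derivative of `rootProfile`. -/
noncomputable def rootProfile' (x : ℝ) : ℝ := (max x 0) / (2 * rad x ^ 3)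

lemma one_le_rad (x : ℝ) : 1 ≤ rad x := by
  rw [rad, Real.one_le_sqrt]; linarith [le_max_right x 0]

lemma rad_pos (x : ℝ) : 0 < rad x := one_pos.trans_le (one_le_rad x)

lemma rad_sq (x : ℝ) : rad x ^ 2 = 1 + max x 0 :=
  Real.sq_sqrt (by linarith [le_max_right x 0])

lemma max_eq_rad (x : ℝ) : max x 0 = rad x ^ 2 - 1 := by rw [rad_sq]; ring

lemma rad_of_nonpos {x : ℝ} (hx : x ≤ 0) : rad x = 1 := by simp [rad, hx]

lemma continuous_rad : Continuous rad := by unfold rad; fun_prop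

lemma continuous_profile : Continuous profile := by
  unfold profile
  exact ((continuous_rad.sub continuous_const).pow 3).div continuous_rad fun x => (rad_pos x).ne'

lemma continuous_profile' : Continuous profile' := by
  unfold profile'
  have h := continuous_rad
  refine (continuous_const.sub (continuous_const.div (by fun_prop) ?_)).add
    (continuous_const.div (by fun_prop) ?_)
  all_goals intro x; have := rad_pos x; positivity

lemma continuous_profile'' : Continuous profile'' := by
  unfold profile''
  have h := continuous_rad
  refine Continuous.div (by fun_prop) (by fun_prop) fun x => ?_
  have := rad_pos x; positivity

lemma continuous_rootProfile : Continuous rootProfile := by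
  unfold rootProfile
  exact ((continuous_rad.sub continuous_const).pow 2).div continuous_rad fun x => (rad_pos x).ne'

lemma continuous_rootProfile' : Continuous rootProfile' := by
  unfold rootProfile'
  have h := continuous_rad
  refine Continuous.div (by fun_prop) (by fun_prop) fun x => ?_
  have := rad_pos x; positivity

lemma hasDerivAt_rad_of_pos {x : ℝ} (hx : 0 < x) : HasDerivAt rad (1 / (2 * rad x)) x := by
  have h : HasDerivAt (fun y : ℝ => √(1 + y)) (1 / (2 * √(1 + x))) x :=
    ((hasDerivAt_id x).const_add 1).sqrt (by simp; linarith)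
  have e : rad x = √(1 + x) := by rw [rad, max_eq_left hx.le]
  rw [e]
  refine h.congr_of_eventuallyEq ?_
  filter_upwards [lt_mem_nhds hx] with y hy
  rw [rad, max_eq_left hy.le]

lemma hasDerivAt_rad_of_neg {x : ℝ} (hx : x < 0) : HasDerivAt rad 0 x := by
  refine (hasDerivAt_const x (1 : ℝ)).congr_of_eventuallyEq ?_
  filter_upwards [gt_mem_nhds hx] with y hy using rad_of_nonpos hy.le

/-- A function of `rad` is differentiable as soon as its formal derivative is continuous. -/
lemma hasDerivAt_comp_rad {F F' g : ℝ → ℝ} (hF : ∀ r, 1 ≤ r → HasDerivAt F (F' r) r)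
    (hc : Continuous fun x => F (rad x)) (hg : Continuous g)
    (hpos : ∀ x, 0 < x → g x = F' (rad x) * (1 / (2 * rad x))) (hneg : ∀ x, x < 0 → g x = 0)
    (x : ℝ) : HasDerivAt (fun x => F (rad x)) (g x) x := by
  refine hasDerivAt_of_hasDerivAt_of_ne' (x := 0) (fun y hy => ?_) hc.continuousAt
    hg.continuousAt x
  rcases lt_or_gt_of_ne hy with h | h
  · have := (hF _ (one_le_rad y)).comp y (hasDerivAt_rad_of_neg h)
    rw [mul_zero] at this
    rw [hneg y h]; exact this
  · rw [hpos y h]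
    exact (hF _ (one_le_rad y)).comp y (hasDerivAt_rad_of_pos h)

lemma hasDerivAt_profile (x : ℝ) : HasDerivAt profile (profile' x) x := by
  refine hasDerivAt_comp_rad (F := fun r => (r - 1) ^ 3 / r)
    (F' := fun r => (3 * (r - 1) ^ 2 * r - (r - 1) ^ 3) / r ^ 2) (fun r hr => ?_)
    continuous_profile continuous_profile' (fun y hy => ?_) (fun y hy => ?_) x
  · have := (((hasDerivAt_id r).sub_const 1).pow 3).div (hasDerivAt_id r) (by simp; linarith)
    refine this.congr_deriv ?_
    simp
  · have := rad_pos y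
    unfold profile'; field_simp; ring
  · simp only [profile', rad_of_nonpos hy.le]; norm_num

lemma hasDerivAt_profile' (x : ℝ) : HasDerivAt profile' (profile'' x) x := by
  refine hasDerivAt_comp_rad (F := fun r => 1 - 3 / (2 * r) + 1 / (2 * r ^ 3))
    (F' := fun r => 3 / (2 * r ^ 2) - 3 / (2 * r ^ 4)) (fun r hr => ?_)
    continuous_profile' continuous_profile'' (fun y hy => ?_) (fun y hy => ?_) x
  · have hr0 : r ≠ 0 := by linarith
    have := (((hasDerivAt_const r (3 : ℝ)).div ((hasDerivAt_id r).const_mul 2)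
      (by simpa using hr0)).const_sub 1).add
      ((hasDerivAt_const r (1 : ℝ)).div (((hasDerivAt_id r).pow 3).const_mul 2)
      (by simpa using hr0))
    refine this.congr_deriv ?_
    simp
    field_simp
    ring
  · have := rad_pos y
    rw [profile'', max_eq_rad]; field_simp
    ring
  · simp [profile'', hy.le]

lemma hasDerivAt_rootProfile (x : ℝ) : HasDerivAt rootProfile (rootProfile' x) x := by
  refine hasDerivAt_comp_rad (F := fun r => (r - 1) ^ 2 / r)
    (F' := fun r => 1 - 1 / r ^ 2) (fun r hr => ?_)
    continuous_rootProfile continuous_rootProfile' (fun y hy => ?_) (fun y hy => ?_) x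
  · have hr0 : r ≠ 0 := by linarith
    have := (((hasDerivAt_id r).sub_const 1).pow 2).div (hasDerivAt_id r) (by simpa using hr0)
    refine this.congr_deriv ?_
    simp
    field_simp
    ring
  · have := rad_pos y
    rw [rootProfile', max_eq_rad]; field_simp
  · simp [rootProfile', hy.le]

lemma profile_nonneg (x : ℝ) : 0 ≤ profile x :=
  div_nonneg (pow_nonneg (by linarith [one_le_rad x]) 3) (rad_pos x).le

lemma profile'_nonneg (x : ℝ) : 0 ≤ profile' x := by
  have h1 := one_le_rad x
  have : profile' x = (rad x - 1) ^ 2 * (2 * rad x + 1) / (2 * rad x ^ 3) := by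
    have := rad_pos x
    unfold profile'; field_simp; ring
  rw [this]; positivity

lemma profile'_le_one (x : ℝ) : profile' x ≤ 1 := by
  have h1 := one_le_rad x
  have : profile' x = 1 - (3 * rad x ^ 2 - 1) / (2 * rad x ^ 3) := by
    have := rad_pos x
    unfold profile'; field_simp; ring
  rw [this]
  have : 0 ≤ (3 * rad x ^ 2 - 1) / (2 * rad x ^ 3) :=
    div_nonneg (by nlinarith) (by positivity)
  linarith

lemma profile''_nonneg (x : ℝ) : 0 ≤ profile'' x := by
  have h1 := one_le_rad x
  have := le_max_right x 0
  unfold profile''; positivity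

lemma profile_le (x : ℝ) : profile x ≤ max x 0 := by
  have h1 := one_le_rad x
  rw [max_eq_rad, profile, div_le_iff₀ (rad_pos x)]
  nlinarith [mul_nonneg (sub_nonneg.2 h1) (sub_nonneg.2 h1)]

/-- The deficit is only of order `√x`, so it disappears when `profile` is rescaled to recover the
positive part. -/
lemma le_profile (x : ℝ) : max x 0 - 3 * rad x ≤ profile x := by
  have h1 := one_le_rad x
  rw [max_eq_rad, profile, le_div_iff₀ (rad_pos x)]
  nlinarith

/-- The Lipschitz bound lets the energy on a fixed box pass to the initial data under mere `L¹_loc`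
convergence. -/
lemma abs_profile_sub_le (x y : ℝ) : |profile x - profile y| ≤ |x - y| := by
  have := Convex.norm_image_sub_le_of_norm_hasDerivWithin_le (f := profile) (f' := profile')
    (s := univ) (C := 1) (x := y) (y := x) (fun z _ => (hasDerivAt_profile z).hasDerivWithinAt)
    (fun z _ => by
      rw [Real.norm_eq_abs, abs_of_nonneg (profile'_nonneg z)]; exact profile'_le_one z)
    convex_univ (mem_univ _) (mem_univ _)
  simpa using this

lemma rootProfile_nonneg (x : ℝ) : 0 ≤ rootProfile x :=
  div_nonneg (sq_nonneg _) (rad_pos x).le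

lemma rootProfile_le (x : ℝ) : rootProfile x ≤ max x 0 := by
  have h1 := one_le_rad x
  rw [max_eq_rad, rootProfile, div_le_iff₀ (rad_pos x)]
  nlinarith [mul_nonneg (sub_nonneg.2 h1) (sub_nonneg.2 h1)]

/-- This compatibility dictates the choice of the two profiles: it gives `|∇(rootProfile ∘ f)|² ≤ f₊
· dissip`, so Cauchy–Schwarz bounds the `L¹` norm of this gradient by mass and dissipation. -/
lemma rootProfile'_sq_le (x : ℝ) : rootProfile' x ^ 2 ≤ max x 0 * profile'' x := by
  have h1 := one_le_rad x
  have h0 := le_max_right x 0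
  have e : max x 0 * profile'' x = (max x 0) ^ 2 * (3 * rad x) / (4 * rad x ^ 6) := by
    have := rad_pos x
    unfold profile''; field_simp
  have e' : rootProfile' x ^ 2 = (max x 0) ^ 2 * 1 / (4 * rad x ^ 6) := by
    have := rad_pos x
    unfold rootProfile'; field_simp; ring
  rw [e, e']
  gcongr
  linarith

/-- Near zero `rootProfile` is of order `x²`, so its square cannot control `x₊`; lowering `x` by one
removes that region. This is why each gain of integrability costs a rise of the level. -/
lemma max_sub_one_le (x : ℝ) : max (x - 1) 0 ≤ 151 * rootProfile x ^ 2 := by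
  rcases le_or_gt x 1 with h | h
  · rw [max_eq_right (by linarith)]; positivity
  have h1 := one_le_rad x
  have hs := rad_sq x
  rw [max_eq_left (by linarith : (0 : ℝ) ≤ x)] at hs
  rw [max_eq_left (by linarith : (0 : ℝ) ≤ x - 1)]
  -- For `x > 1` the radius exceeds `√2`. The bound `r ≥ 1.4` is equivalent to `r ≤ 3.5 (r - 1)`,
  -- and `3.5⁴ = 150.0625` yields 151.
  have hr : 1.4 ≤ rad x := by nlinarith
  have h2 : rad x ≤ 3.5 * (rad x - 1) := by linarith
  have h3 : x - 1 ≤ rad x ^ 2 := by linarith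
  refine h3.trans ?_
  rw [rootProfile, div_pow, ← mul_div_assoc, le_div_iff₀ (by positivity)]
  calc rad x ^ 2 * rad x ^ 2 = rad x ^ 4 := by ring
    _ ≤ (3.5 * (rad x - 1)) ^ 4 := by gcongr
    _ ≤ 151 * ((rad x - 1) ^ 2) ^ 2 := by
      have : 0 ≤ (rad x - 1) ^ 4 := by positivity
      nlinarith

/-! ### Integration by parts on a period box -/

/-- The rectangle `[-L, L] × [0, 1]`. -/
def box (L : ℝ) : Set (ℝ × ℝ) := Icc (-L, 0) (L, 1)

lemma isCompact_box (L : ℝ) : IsCompact (box L) := isCompact_Icc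

lemma measurableSet_box (L : ℝ) : MeasurableSet (box L) := measurableSet_Icc

lemma mem_box {L : ℝ} {z : ℝ × ℝ} : z ∈ box L ↔ |z.1| ≤ L ∧ z.2 ∈ Icc (0 : ℝ) 1 := by
  rw [box, mem_Icc, Prod.le_def, Prod.le_def, abs_le, mem_Icc]; tauto

lemma fderiv_apply_fst {F : ℝ × ℝ → ℝ} {z : ℝ × ℝ} {a : ℝ} (hF : DifferentiableAt ℝ F z)
    (h : HasDerivAt (fun s => F (s, z.2)) a z.1) : fderiv ℝ F z (1, 0) = a := by
  have h1 : HasDerivAt (fun s : ℝ => (s, z.2)) ((1 : ℝ), (0 : ℝ)) z.1 :=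
    (hasDerivAt_id _).prodMk (hasDerivAt_const _ _)
  have h2 : HasFDerivAt F (fderiv ℝ F z) ((fun s : ℝ => (s, z.2)) z.1) := hF.hasFDerivAt
  exact (h2.comp_hasDerivAt z.1 h1).unique h

lemma fderiv_apply_snd {F : ℝ × ℝ → ℝ} {z : ℝ × ℝ} {a : ℝ} (hF : DifferentiableAt ℝ F z)
    (h : HasDerivAt (fun s => F (z.1, s)) a z.2) : fderiv ℝ F z (0, 1) = a := by
  have h1 : HasDerivAt (fun s : ℝ => (z.1, s)) ((0 : ℝ), (1 : ℝ)) z.2 :=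
    (hasDerivAt_const _ _).prodMk (hasDerivAt_id _)
  have h2 : HasFDerivAt F (fderiv ℝ F z) ((fun s : ℝ => (z.1, s)) z.2) := hF.hasFDerivAt
  exact (h2.comp_hasDerivAt z.2 h1).unique h

lemma hasDerivAt_slice_fst {F : ℝ × ℝ → ℝ} (hF : ContDiff ℝ 1 F) (z : ℝ × ℝ) :
    HasDerivAt (fun s => F (s, z.2)) (fderiv ℝ F z (1, 0)) z.1 := by
  have h1 : HasDerivAt (fun s : ℝ => (s, z.2)) ((1 : ℝ), (0 : ℝ)) z.1 :=
    (hasDerivAt_id _).prodMk (hasDerivAt_const _ _)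
  have h2 : HasFDerivAt F (fderiv ℝ F z) ((fun s : ℝ => (s, z.2)) z.1) :=
    (hF.differentiable one_ne_zero z).hasFDerivAt
  exact h2.comp_hasDerivAt z.1 h1

lemma hasDerivAt_slice_snd {F : ℝ × ℝ → ℝ} (hF : ContDiff ℝ 1 F) (z : ℝ × ℝ) :
    HasDerivAt (fun s => F (z.1, s)) (fderiv ℝ F z (0, 1)) z.2 := by
  have h1 : HasDerivAt (fun s : ℝ => (z.1, s)) ((0 : ℝ), (1 : ℝ)) z.2 :=
    (hasDerivAt_const _ _).prodMk (hasDerivAt_id _)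
  have h2 : HasFDerivAt F (fderiv ℝ F z) ((fun s : ℝ => (z.1, s)) z.2) :=
    (hF.differentiable one_ne_zero z).hasFDerivAt
  exact h2.comp_hasDerivAt z.2 h1

/-- Integration by parts of `Δv - u · ∇v` against a weight in the first variable, on a rectangle
that is a full period in the second variable. -/
lemma setIntegral_box_parts {v vx vy vxx vyy u₁ u₂ : ℝ × ℝ → ℝ} {χ χ' χ'' : ℝ → ℝ} {L : ℝ}
    (hL : 0 ≤ L)
    (hv : ContDiff ℝ 1 v) (hvx : ContDiff ℝ 1 vx) (hvy : ContDiff ℝ 1 vy)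
    (hu₁ : ContDiff ℝ 1 u₁) (hu₂ : ContDiff ℝ 1 u₂)
    (dvx : ∀ z, HasDerivAt (fun s => v (s, z.2)) (vx z) z.1)
    (dvy : ∀ z, HasDerivAt (fun s => v (z.1, s)) (vy z) z.2)
    (dvxx : ∀ z, HasDerivAt (fun s => vx (s, z.2)) (vxx z) z.1)
    (dvyy : ∀ z, HasDerivAt (fun s => vy (z.1, s)) (vyy z) z.2)
    (hdiv : ∀ z, fderiv ℝ u₁ z (1, 0) + fderiv ℝ u₂ z (0, 1) = 0)
    (pv : ∀ x, v (x, 1) = v (x, 0)) (pvy : ∀ x, vy (x, 1) = vy (x, 0))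
    (pu : ∀ x, u₂ (x, 1) = u₂ (x, 0))
    (hχ : ContDiff ℝ 1 χ) (hχ' : ContDiff ℝ 1 χ')
    (dχ : ∀ x, HasDerivAt χ (χ' x) x) (dχ' : ∀ x, HasDerivAt χ' (χ'' x) x)
    (χL : χ L = 0) (χL' : χ (-L) = 0) (χ'L : χ' L = 0) (χ'L' : χ' (-L) = 0) :
    ∫ z in box L, χ z.1 * (vxx z + vyy z - (u₁ z * vx z + u₂ z * vy z))
      = ∫ z in box L, v z * (χ'' z.1 + u₁ z * χ' z.1) := by
  -- The field `(F, G)` is chosen so that its divergence is the difference of the two integrands, up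
  -- to a multiple of `div u`.
  set F : ℝ × ℝ → ℝ := fun z => χ z.1 * vx z - χ' z.1 * v z - u₁ z * χ z.1 * v z with hFd
  set G : ℝ × ℝ → ℝ := fun z => χ z.1 * vy z - u₂ z * χ z.1 * v z with hGd
  have hF : ContDiff ℝ 1 F := by
    have h1 : ContDiff ℝ 1 (fun z : ℝ × ℝ => χ z.1) := hχ.comp contDiff_fst
    have h2 : ContDiff ℝ 1 (fun z : ℝ × ℝ => χ' z.1) := hχ'.comp contDiff_fst
    exact ((h1.mul hvx).sub (h2.mul hv)).sub ((hu₁.mul h1).mul hv)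
  have hG : ContDiff ℝ 1 G := by
    have h1 : ContDiff ℝ 1 (fun z : ℝ × ℝ => χ z.1) := hχ.comp contDiff_fst
    exact (h1.mul hvy).sub ((hu₂.mul h1).mul hv)
  have eF : ∀ z, fderiv ℝ F z (1, 0) = χ z.1 * vxx z - χ'' z.1 * v z
      - (fderiv ℝ u₁ z (1, 0) * χ z.1 * v z + u₁ z * χ' z.1 * v z + u₁ z * χ z.1 * vx z) := by
    intro z
    refine fderiv_apply_fst (hF.differentiable one_ne_zero z) ?_
    have := (((dχ z.1).mul (dvxx z)).sub ((dχ' z.1).mul (dvx z))).sub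
      (((hasDerivAt_slice_fst hu₁ z).mul (dχ z.1)).mul (dvx z))
    refine this.congr_deriv ?_
    simp only [Pi.mul_apply]
    ring
  have eG : ∀ z, fderiv ℝ G z (0, 1) = χ z.1 * vyy z
      - (fderiv ℝ u₂ z (0, 1) * χ z.1 * v z + u₂ z * χ z.1 * vy z) := by
    intro z
    refine fderiv_apply_snd (hG.differentiable one_ne_zero z) ?_
    have := ((dvyy z).const_mul (χ z.1)).sub
      (((hasDerivAt_slice_snd hu₂ z).mul_const (χ z.1)).mul (dvy z))
    refine this.congr_deriv ?_
    ring
  have cF : Continuous fun z => fderiv ℝ F z (1, 0) :=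
    (hF.continuous_fderiv one_ne_zero).clm_apply continuous_const
  have cG : Continuous fun z => fderiv ℝ G z (0, 1) :=
    (hG.continuous_fderiv one_ne_zero).clm_apply continuous_const
  have key := integral_divergence_prod_Icc_of_hasFDerivAt_of_le F G (fderiv ℝ F) (fderiv ℝ G)
    ((-L, 0) : ℝ × ℝ) (L, 1) ⟨by simpa using hL, by simp⟩ hF.continuous.continuousOn
    hG.continuous.continuousOn (fun z _ => (hF.differentiable one_ne_zero z).hasFDerivAt)
    (fun z _ => (hG.differentiable one_ne_zero z).hasFDerivAt)
    ((cF.add cG).continuousOn.integrableOn_compact isCompact_Icc)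
  -- The vertical sides contribute nothing since both the cutoff and its slope vanish there; the
  -- horizontal sides cancel by periodicity.
  have b1 : ∀ y, F (L, y) = 0 := fun y => by simp [hFd, χL, χ'L]
  have b2 : ∀ y, F (-L, y) = 0 := fun y => by simp [hFd, χL', χ'L']
  have b3 : ∀ x, G (x, 1) = G (x, 0) := fun x => by simp [hGd, pv, pvy, pu]
  simp only [b1, b2, b3, sub_self, intervalIntegral.integral_zero, add_zero] at key
  have cvxx : Continuous vxx := by
    have : vxx = fun z => fderiv ℝ vx z (1, 0) := by
      ext z; exact (fderiv_apply_fst (hvx.differentiable one_ne_zero z) (dvxx z)).symm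
    rw [this]; exact (hvx.continuous_fderiv one_ne_zero).clm_apply continuous_const
  have cvyy : Continuous vyy := by
    have : vyy = fun z => fderiv ℝ vy z (0, 1) := by
      ext z; exact (fderiv_apply_snd (hvy.differentiable one_ne_zero z) (dvyy z)).symm
    rw [this]; exact (hvy.continuous_fderiv one_ne_zero).clm_apply continuous_const
  have cχ := hχ.continuous
  have cχ' := hχ'.continuous
  have cvx := hvx.continuous
  have cvy := hvy.continuous
  have cv := hv.continuous
  have cu₁ := hu₁.continuous
  have cu₂ := hu₂.continuous
  have cχ'' : Continuous χ'' := by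
    have : χ'' = deriv χ' := by ext x; exact (dχ' x).deriv.symm
    rw [this]; exact hχ'.continuous_deriv_one
  have i1 : IntegrableOn (fun z : ℝ × ℝ => χ z.1 * (vxx z + vyy z - (u₁ z * vx z + u₂ z * vy z)))
      (box L) := Continuous.integrableOn_Icc (by fun_prop)
  have i2 : IntegrableOn (fun z : ℝ × ℝ => v z * (χ'' z.1 + u₁ z * χ' z.1))
      (box L) := Continuous.integrableOn_Icc (by fun_prop)
  rw [← sub_eq_zero, ← integral_sub i1 i2, ← key]
  refine integral_congr_ae (Eventually.of_forall fun z => ?_)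
  simp only [eF, eG]
  have := hdiv z
  linear_combination (-(χ z.1 * v z)) * (-this)

/-! ### Solutions on the strip `ℝ × [0, 1]` -/

/-- The time derivative of a function of `(t, (x, y))`. -/
noncomputable def dt (f : ℝ → ℝ × ℝ → ℝ) (t : ℝ) (z : ℝ × ℝ) : ℝ := deriv (fun s => f s z) t

/-- The first spatial derivative of a function of `(t, (x, y))`. -/
noncomputable def dx (f : ℝ → ℝ × ℝ → ℝ) (t : ℝ) (z : ℝ × ℝ) : ℝ :=
  deriv (fun s => f t (s, z.2)) z.1

/-- The second spatial derivative of a function of `(t, (x, y))`. -/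
noncomputable def dy (f : ℝ → ℝ × ℝ → ℝ) (t : ℝ) (z : ℝ × ℝ) : ℝ :=
  deriv (fun s => f t (z.1, s)) z.2

/-- The set of positive times. -/
def posTime : Set (ℝ × ℝ × ℝ) := {p | 0 < p.1}

lemma isOpen_posTime : IsOpen posTime := isOpen_lt continuous_const continuous_fst

/-- Drifts on the strip. -/
structure StripDrift (u₁ u₂ : ℝ → ℝ × ℝ → ℝ) : Prop where
  contDiff₁ : ∀ t, 0 < t → ContDiff ℝ 1 (u₁ t)
  contDiff₂ : ∀ t, 0 < t → ContDiff ℝ 1 (u₂ t)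
  continuousOn₁ : ContinuousOn (fun p : ℝ × ℝ × ℝ => u₁ p.1 p.2) posTime
  div_free : ∀ t, 0 < t → ∀ z, fderiv ℝ (u₁ t) z (1, 0) + fderiv ℝ (u₂ t) z (0, 1) = 0
  periodic₂ : ∀ t, 0 < t → ∀ x, u₂ t (x, 1) = u₂ t (x, 0)
  bounded : ∀ T, 0 < T → ∃ M : ℝ, ∀ t ∈ Ioc 0 T, ∀ z, |u₁ t z| ≤ M

/-- Solutions of the drift-diffusion equation on the strip, periodic in the second variable. -/
structure StripSolution (u₁ u₂ : ℝ → ℝ × ℝ → ℝ) (f₀ : ℝ × ℝ → ℝ) (f : ℝ → ℝ × ℝ → ℝ) :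
    Prop where
  continuousOn : ContinuousOn (fun p : ℝ × ℝ × ℝ => f p.1 p.2) posTime
  continuousOn_dt : ContinuousOn (fun p : ℝ × ℝ × ℝ => dt f p.1 p.2) posTime
  continuousOn_dx : ContinuousOn (fun p : ℝ × ℝ × ℝ => dx f p.1 p.2) posTime
  continuousOn_dy : ContinuousOn (fun p : ℝ × ℝ × ℝ => dy f p.1 p.2) posTime
  differentiableAt : ∀ t, 0 < t → ∀ z, DifferentiableAt ℝ (fun s => f s z) t
  contDiff : ∀ t, 0 < t → ContDiff ℝ 1 (f t)
  contDiff_dx : ∀ t, 0 < t → ContDiff ℝ 1 (dx f t)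
  contDiff_dy : ∀ t, 0 < t → ContDiff ℝ 1 (dy f t)
  periodic : ∀ t, 0 < t → ∀ x, f t (x, 1) = f t (x, 0)
  periodic_dy : ∀ t, 0 < t → ∀ x, dy f t (x, 1) = dy f t (x, 0)
  equation : ∀ t, 0 < t → ∀ z,
    dt f t z + (u₁ t z * dx f t z + u₂ t z * dy f t z) = dx (dx f) t z + dy (dy f) t z
  uloc_bounded : ∀ T, 0 < T → ∃ C : ℝ≥0, ∀ t ∈ Ioc 0 T, ∀ a : ℝ,
    ∫⁻ z in Icc a (a + 1) ×ˢ Icc (0 : ℝ) 1, ‖f t z‖ₑ ≤ C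
  aemeasurable : AEMeasurable f₀ (volume.restrict (univ ×ˢ Icc (0 : ℝ) 1))
  initial : ∀ R, 0 < R →
    Tendsto (fun t => ∫⁻ z in box R, ‖f t z - f₀ z‖ₑ) (𝓝[>] 0) (𝓝 0)

variable {u₁ u₂ : ℝ → ℝ × ℝ → ℝ} {f₀ : ℝ × ℝ → ℝ} {f : ℝ → ℝ × ℝ → ℝ}

lemma hasDerivAt_dx {t : ℝ} (hf : ContDiff ℝ 1 (f t)) (z : ℝ × ℝ) :
    HasDerivAt (fun s => f t (s, z.2)) (dx f t z) z.1 :=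
  (hasDerivAt_slice_fst hf z).differentiableAt.hasDerivAt

lemma hasDerivAt_dy {t : ℝ} (hf : ContDiff ℝ 1 (f t)) (z : ℝ × ℝ) :
    HasDerivAt (fun s => f t (z.1, s)) (dy f t z) z.2 :=
  (hasDerivAt_slice_snd hf z).differentiableAt.hasDerivAt

/-! ### The cutoff -/

/-- A polynomial that is a cutoff on `[-L, L]`, with vanishing value and slope at the ends. -/
noncomputable def cutoff (L x : ℝ) : ℝ := (1 - (x / L) ^ 2) ^ 2

/-- The derivative of `cutoff L`. -/
noncomputable def cutoff' (L x : ℝ) : ℝ := -4 * x / L ^ 2 * (1 - (x / L) ^ 2)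

/-- The second derivative of `cutoff L`. -/
noncomputable def cutoff'' (L x : ℝ) : ℝ := -4 / L ^ 2 + 12 * x ^ 2 / L ^ 4

lemma hasDerivAt_cutoff (L x : ℝ) : HasDerivAt (cutoff L) (cutoff' L x) x := by
  have := ((((hasDerivAt_id x).div_const L).pow 2).const_sub 1).pow 2
  refine this.congr_deriv ?_
  simp [cutoff']
  ring

lemma hasDerivAt_cutoff' (L x : ℝ) : HasDerivAt (cutoff' L) (cutoff'' L x) x := by
  have := (((hasDerivAt_id x).const_mul (-4)).div_const (L ^ 2)).mul
    ((((hasDerivAt_id x).div_const L).pow 2).const_sub 1)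
  refine this.congr_deriv ?_
  simp [cutoff'']
  ring

lemma contDiff_cutoff (L : ℝ) : ContDiff ℝ 1 (cutoff L) := by unfold cutoff; fun_prop

lemma contDiff_cutoff' (L : ℝ) : ContDiff ℝ 1 (cutoff' L) := by unfold cutoff'; fun_prop

lemma continuous_cutoff'' (L : ℝ) : Continuous (cutoff'' L) := by unfold cutoff''; fun_prop

lemma cutoff_nonneg (L x : ℝ) : 0 ≤ cutoff L x := sq_nonneg _

lemma sq_div_le_one {L x : ℝ} (hx : |x| ≤ L) : (x / L) ^ 2 ≤ 1 := by
  rw [div_pow]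
  exact div_le_one_of_le₀ (sq_le_sq' (abs_le.1 hx).1 (abs_le.1 hx).2) (sq_nonneg _)

lemma cutoff_le_one {L x : ℝ} (hx : |x| ≤ L) : cutoff L x ≤ 1 := by
  have h1 := sq_div_le_one hx
  have h0 := sq_nonneg (x / L)
  unfold cutoff
  nlinarith

/-- Monotonicity in `L` allows the cutoff to be removed by monotone convergence, without knowing
beforehand that the limit is finite. -/
lemma cutoff_mono {L L' x : ℝ} (hL : 0 < L) (hx : |x| ≤ L) (h : L ≤ L') :
    cutoff L x ≤ cutoff L' x := by
  have h1 := sq_div_le_one hx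
  have h2 : (x / L') ^ 2 ≤ (x / L) ^ 2 := by
    rw [div_pow, div_pow]
    gcongr
  unfold cutoff
  nlinarith [sq_nonneg (x / L')]

lemma tendsto_cutoff (x : ℝ) : Tendsto (fun n : ℕ => cutoff (n + 1) x) atTop (𝓝 1) := by
  have h : Tendsto (fun n : ℕ => x / ((n : ℝ) + 1)) atTop (𝓝 0) := by
    have := (tendsto_one_div_add_atTop_nhds_zero_nat (𝕜 := ℝ)).const_mul x
    simpa [div_eq_mul_inv] using this
  have := ((h.pow 2).const_sub 1).pow 2
  simpa [cutoff] using this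

lemma abs_cutoff'_le {L x : ℝ} (hL : 1 ≤ L) (hx : |x| ≤ L) : |cutoff' L x| ≤ 4 / L := by
  have h1 := sq_div_le_one hx
  have h0 := sq_nonneg (x / L)
  have hL0 : 0 < L := by linarith
  rw [cutoff', abs_mul, abs_div, abs_mul, abs_of_nonneg (sq_nonneg L),
    abs_of_nonneg (by linarith : 0 ≤ 1 - (x / L) ^ 2)]
  calc |(-4 : ℝ)| * |x| / L ^ 2 * (1 - (x / L) ^ 2) ≤ |(-4 : ℝ)| * L / L ^ 2 * 1 := by
        gcongr
        linarith
    _ = 4 / L := by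
        rw [abs_neg, abs_of_nonneg (by norm_num : (0 : ℝ) ≤ 4)]; field_simp

lemma abs_cutoff''_le {L x : ℝ} (hL : 1 ≤ L) (hx : |x| ≤ L) : |cutoff'' L x| ≤ 12 / L := by
  have h1 := sq_div_le_one hx
  have h0 := sq_nonneg (x / L)
  have hL0 : 0 < L := by linarith
  have e : cutoff'' L x = (-4 + 12 * (x / L) ^ 2) / L ^ 2 := by
    unfold cutoff''; field_simp
  rw [e, abs_div, abs_of_nonneg (sq_nonneg L)]
  calc |-4 + 12 * (x / L) ^ 2| / L ^ 2 ≤ 12 / L ^ 2 := by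
        gcongr
        rw [abs_le]; constructor <;> linarith
    _ ≤ 12 / L := by
        gcongr
        nlinarith

/-! ### The localized energy identity -/

/-- The energy dissipation density of `profile ∘ f`. -/
noncomputable def dissip (f : ℝ → ℝ × ℝ → ℝ) (t : ℝ) (z : ℝ × ℝ) : ℝ :=
  profile'' (f t z) * (dx f t z ^ 2 + dy f t z ^ 2)

lemma dissip_nonneg (f : ℝ → ℝ × ℝ → ℝ) (t : ℝ) (z : ℝ × ℝ) : 0 ≤ dissip f t z :=
  mul_nonneg (profile''_nonneg _) (by positivity)

lemma integrable_prod_box {F : ℝ × ℝ × ℝ → ℝ} (hF : ContinuousOn F posTime) {s t : ℝ}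
    (hs : 0 < s) (L : ℝ) :
    Integrable F ((volume.restrict (Ioc s t)).prod (volume.restrict (box L))) := by
  rw [Measure.prod_restrict]
  have hK : IsCompact (Icc s t ×ˢ box L) := isCompact_Icc.prod (isCompact_box L)
  have : IntegrableOn F (Icc s t ×ˢ box L) (volume.prod volume) := by
    refine (hF.mono fun p hp => ?_).integrableOn_compact hK
    exact hs.trans_le hp.1.1
  exact this.mono_set (prod_mono_left Ioc_subset_Icc_self)

lemma StripSolution.continuousOn_dissip (h : StripSolution u₁ u₂ f₀ f) :
    ContinuousOn (fun p : ℝ × ℝ × ℝ => dissip f p.1 p.2) posTime :=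
  (continuous_profile''.comp_continuousOn h.continuousOn).mul
    ((h.continuousOn_dx.pow 2).add (h.continuousOn_dy.pow 2))

lemma continuous_slice {F : ℝ × ℝ × ℝ → ℝ} (hF : ContinuousOn F posTime) {t : ℝ} (ht : 0 < t) :
    Continuous fun z => F (t, z) := by
  rw [← continuousOn_univ]
  exact hF.comp (by fun_prop) fun z _ => ht

/-- Multiply the equation by `χ profile'(f)` and integrate by parts. The chain rule for second
derivatives leaves the term `profile''(f) |∇f|²`, which is the dissipation; as `χ` depends on `x₁`
only, `u₂` drops out. -/
lemma StripSolution.setIntegral_dt (h : StripSolution u₁ u₂ f₀ f) (hu : StripDrift u₁ u₂)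
    {t : ℝ} (ht : 0 < t) {L : ℝ} (hL : 0 < L) :
    ∫ z in box L, cutoff L z.1 * (profile' (f t z) * dt f t z)
      = (∫ z in box L, profile (f t z) * (cutoff'' L z.1 + u₁ t z * cutoff' L z.1))
        - ∫ z in box L, cutoff L z.1 * dissip f t z := by
  have hP1 : ContDiff ℝ 1 profile' := by
    rw [contDiff_one_iff_deriv]
    refine ⟨fun x => (hasDerivAt_profile' x).differentiableAt, ?_⟩
    have : deriv profile' = profile'' := by ext x; exact (hasDerivAt_profile' x).deriv
    rw [this]; exact continuous_profile''
  have hP : ContDiff ℝ 1 profile := by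
    rw [contDiff_one_iff_deriv]
    refine ⟨fun x => (hasDerivAt_profile x).differentiableAt, ?_⟩
    have : deriv profile = profile' := by ext x; exact (hasDerivAt_profile x).deriv
    rw [this]; exact continuous_profile'
  have hf := h.contDiff t ht
  have hfx := h.contDiff_dx t ht
  have hfy := h.contDiff_dy t ht
  have key := setIntegral_box_parts (v := fun z => profile (f t z))
    (vx := fun z => profile' (f t z) * dx f t z) (vy := fun z => profile' (f t z) * dy f t z)
    (vxx := fun z => profile'' (f t z) * dx f t z * dx f t z + profile' (f t z) * dx (dx f) t z)
    (vyy := fun z => profile'' (f t z) * dy f t z * dy f t z + profile' (f t z) * dy (dy f) t z)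
    (u₁ := u₁ t) (u₂ := u₂ t) (χ := cutoff L) (χ' := cutoff' L) (χ'' := cutoff'' L) hL.le
    (hP.comp hf) ((hP1.comp hf).mul hfx) ((hP1.comp hf).mul hfy) (hu.contDiff₁ t ht)
    (hu.contDiff₂ t ht)
    (fun z => (hasDerivAt_profile _).comp z.1 (hasDerivAt_dx hf z))
    (fun z => (hasDerivAt_profile _).comp z.2 (hasDerivAt_dy hf z))
    (fun z => ((hasDerivAt_profile' _).comp z.1 (hasDerivAt_dx hf z)).mul (hasDerivAt_dx hfx z))
    (fun z => ((hasDerivAt_profile' _).comp z.2 (hasDerivAt_dy hf z)).mul (hasDerivAt_dy hfy z))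
    (hu.div_free t ht) (fun x => by rw [h.periodic t ht])
    (fun x => by rw [h.periodic t ht, h.periodic_dy t ht]) (hu.periodic₂ t ht)
    (contDiff_cutoff L) (contDiff_cutoff' L) (hasDerivAt_cutoff L) (hasDerivAt_cutoff' L)
    (by simp [cutoff, hL.ne']) (by simp [cutoff, hL.ne'])
    (by simp [cutoff', hL.ne']) (by simp [cutoff', hL.ne'])
  rw [← key, eq_sub_iff_add_eq, ← integral_add]
  · refine integral_congr_ae (Eventually.of_forall fun z => ?_)
    have := h.equation t ht z
    simp only [dissip]
    linear_combination (cutoff L z.1 * profile' (f t z)) * this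
  · refine Continuous.integrableOn_Icc ?_
    exact ((contDiff_cutoff L).continuous.comp continuous_fst).mul
      ((continuous_profile'.comp hf.continuous).mul (continuous_slice h.continuousOn_dt ht))
  · refine Continuous.integrableOn_Icc ?_
    exact ((contDiff_cutoff L).continuous.comp continuous_fst).mul
      (continuous_slice h.continuousOn_dissip ht)

/-- The energy identity for `profile ∘ f`, localized by a cutoff. -/
lemma StripSolution.energy_identity (h : StripSolution u₁ u₂ f₀ f) (hu : StripDrift u₁ u₂)
    {s t : ℝ} (hs : 0 < s) (hst : s ≤ t) {L : ℝ} (hL : 0 < L) :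
    (∫ z in box L, cutoff L z.1 * profile (f t z))
        + ∫ τ in Ioc s t, ∫ z in box L, cutoff L z.1 * dissip f τ z
      = (∫ z in box L, cutoff L z.1 * profile (f s z))
        + ∫ τ in Ioc s t, ∫ z in box L,
            profile (f τ z) * (cutoff'' L z.1 + u₁ τ z * cutoff' L z.1) := by
  have cχ : Continuous fun p : ℝ × ℝ × ℝ => cutoff L p.2.1 :=
    (contDiff_cutoff L).continuous.comp (continuous_fst.comp continuous_snd)
  have cχ' : Continuous fun p : ℝ × ℝ × ℝ => cutoff' L p.2.1 :=
    (contDiff_cutoff' L).continuous.comp (continuous_fst.comp continuous_snd)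
  have cχ'' : Continuous fun p : ℝ × ℝ × ℝ => cutoff'' L p.2.1 :=
    (continuous_cutoff'' L).comp (continuous_fst.comp continuous_snd)
  have cH : ContinuousOn (fun p : ℝ × ℝ × ℝ =>
      cutoff L p.2.1 * (profile' (f p.1 p.2) * dt f p.1 p.2)) posTime :=
    cχ.continuousOn.mul
      ((continuous_profile'.comp_continuousOn h.continuousOn).mul h.continuousOn_dt)
  have cP : ContinuousOn (fun p : ℝ × ℝ × ℝ => cutoff L p.2.1 * dissip f p.1 p.2) posTime :=
    cχ.continuousOn.mul h.continuousOn_dissip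
  have cQ : ContinuousOn (fun p : ℝ × ℝ × ℝ =>
      profile (f p.1 p.2) * (cutoff'' L p.2.1 + u₁ p.1 p.2 * cutoff' L p.2.1)) posTime :=
    (continuous_profile.comp_continuousOn h.continuousOn).mul
      (cχ''.continuousOn.add (hu.continuousOn₁.mul cχ'.continuousOn))
  have ht : 0 < t := hs.trans_le hst
  have cv : ∀ {r : ℝ}, 0 < r → IntegrableOn (fun z => cutoff L z.1 * profile (f r z)) (box L) :=
    fun {r} hr => Continuous.integrableOn_Icc
      (((contDiff_cutoff L).continuous.comp continuous_fst).mul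
        (continuous_profile.comp (h.contDiff r hr).continuous))
  have ftc : ∀ z, cutoff L z.1 * profile (f t z) - cutoff L z.1 * profile (f s z)
      = ∫ τ in Ioc s t, cutoff L z.1 * (profile' (f τ z) * dt f τ z) := by
    intro z
    rw [← intervalIntegral.integral_of_le hst]
    refine (intervalIntegral.integral_eq_sub_of_hasDerivAt
      (f := fun τ => cutoff L z.1 * profile (f τ z)) (fun τ hτ => ?_) ?_).symm
    · rw [uIcc_of_le hst] at hτ
      exact ((hasDerivAt_profile _).comp τ
        (h.differentiableAt τ (hs.trans_le hτ.1) z).hasDerivAt).const_mul _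
    · refine ContinuousOn.intervalIntegrable ?_
      rw [uIcc_of_le hst]
      exact cH.comp (f := fun τ : ℝ => ((τ, z) : ℝ × ℝ × ℝ)) (by fun_prop)
        fun τ hτ => hs.trans_le hτ.1
  have e1 : (∫ z in box L, cutoff L z.1 * profile (f t z))
      - (∫ z in box L, cutoff L z.1 * profile (f s z))
      = ∫ τ in Ioc s t, ∫ z in box L, cutoff L z.1 * (profile' (f τ z) * dt f τ z) := by
    rw [← integral_sub (cv ht) (cv hs)]
    simp_rw [ftc]
    exact (integral_integral_swap (integrable_prod_box cH hs L)).symm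
  have e2 : (∫ τ in Ioc s t, ∫ z in box L, cutoff L z.1 * (profile' (f τ z) * dt f τ z))
      = (∫ τ in Ioc s t, ∫ z in box L,
            profile (f τ z) * (cutoff'' L z.1 + u₁ τ z * cutoff' L z.1))
        - ∫ τ in Ioc s t, ∫ z in box L, cutoff L z.1 * dissip f τ z := by
    rw [← integral_sub (integrable_prod_box cQ hs L).integral_prod_left
      (integrable_prod_box cP hs L).integral_prod_left]
    exact setIntegral_congr_fun measurableSet_Ioc fun τ hτ =>
      h.setIntegral_dt hu (hs.trans hτ.1) hL
  linarith

/-! ### The global energy inequality -/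

/-- The strip `ℝ × [0, 1]`. -/
def strip : Set (ℝ × ℝ) := univ ×ˢ Icc (0 : ℝ) 1

lemma measurableSet_strip : MeasurableSet strip := MeasurableSet.univ.prod measurableSet_Icc

lemma box_subset_strip (L : ℝ) : box L ⊆ strip := fun _ hz => ⟨mem_univ _, (mem_box.1 hz).2⟩

lemma box_mono {L L' : ℝ} (h : L ≤ L') : box L ⊆ box L' := fun _ hz =>
  mem_box.2 ⟨(mem_box.1 hz).1.trans h, (mem_box.1 hz).2⟩

/-- The restriction to the box `[-L, L] × [0, 1]` weighted by the cutoff. -/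
noncomputable def localize (L : ℝ) (F : ℝ × ℝ → ℝ) (z : ℝ × ℝ) : ℝ≥0∞ :=
  (box L).indicator (fun z => ENNReal.ofReal (cutoff L z.1 * F z)) z

lemma lintegral_localize (L : ℝ) (F : ℝ × ℝ → ℝ) :
    ∫⁻ z in strip, localize L F z = ∫⁻ z in box L, ENNReal.ofReal (cutoff L z.1 * F z) := by
  unfold localize
  rw [lintegral_indicator (measurableSet_box L), Measure.restrict_restrict (measurableSet_box L),
    inter_eq_left.2 (box_subset_strip L)]

lemma monotone_localize {F : ℝ × ℝ → ℝ} (hF : ∀ z, 0 ≤ F z) (z : ℝ × ℝ) :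
    Monotone fun n : ℕ => localize (n + 1) F z := by
  intro m n hmn
  have hmn' : (m : ℝ) + 1 ≤ n + 1 := by gcongr
  simp only [localize]
  by_cases hz : z ∈ box (m + 1)
  · rw [indicator_of_mem hz, indicator_of_mem (box_mono hmn' hz)]
    refine ENNReal.ofReal_le_ofReal (mul_le_mul_of_nonneg_right ?_ (hF z))
    exact cutoff_mono (by positivity) (mem_box.1 hz).1 hmn'
  · rw [indicator_of_notMem hz]; exact zero_le

lemma tendsto_localize (F : ℝ × ℝ → ℝ) {z : ℝ × ℝ} (hz : z ∈ strip) :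
    Tendsto (fun n : ℕ => localize (n + 1) F z) atTop (𝓝 (ENNReal.ofReal (F z))) := by
  have h1 : Tendsto (fun n : ℕ => ENNReal.ofReal (cutoff (n + 1) z.1 * F z)) atTop
      (𝓝 (ENNReal.ofReal (F z))) := by
    have := (tendsto_cutoff z.1).mul_const (F z)
    rw [one_mul] at this
    exact ENNReal.tendsto_ofReal this
  refine h1.congr' ?_
  obtain ⟨N, hN⟩ := exists_nat_ge |z.1|
  filter_upwards [eventually_ge_atTop N] with n hn
  rw [localize, indicator_of_mem]
  refine mem_box.2 ⟨hN.trans ?_, hz.2⟩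
  have : (N : ℝ) ≤ n := by exact_mod_cast hn
  linarith

lemma aemeasurable_localize (L : ℝ) {F : ℝ × ℝ → ℝ} {μ : Measure (ℝ × ℝ)}
    (hF : AEMeasurable F μ) : AEMeasurable (localize L F) μ := by
  refine AEMeasurable.indicator (AEMeasurable.ennreal_ofReal (AEMeasurable.mul ?_ hF))
    (measurableSet_box L)
  exact ((contDiff_cutoff L).continuous.comp continuous_fst).aemeasurable

lemma tendsto_lintegral_localize {F : ℝ × ℝ → ℝ} (hF : ∀ z, 0 ≤ F z)
    (hm : AEMeasurable F (volume.restrict strip)) :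
    Tendsto (fun n : ℕ => ∫⁻ z in strip, localize (n + 1) F z) atTop
      (𝓝 (∫⁻ z in strip, ENNReal.ofReal (F z))) := by
  refine lintegral_tendsto_of_tendsto_of_monotone (fun n => aemeasurable_localize _ hm)
    (Eventually.of_forall fun z => monotone_localize hF z) ?_
  filter_upwards [ae_restrict_mem measurableSet_strip] with z hz using tendsto_localize F hz

lemma aemeasurable_prod_strip {F : ℝ × ℝ × ℝ → ℝ} (hF : ContinuousOn F posTime) {s t : ℝ}
    (hs : 0 ≤ s) :
    AEMeasurable F ((volume.restrict (Ioc s t)).prod (volume.restrict strip)) := by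
  rw [Measure.prod_restrict]
  refine (hF.mono fun p hp => ?_).aemeasurable (measurableSet_Ioc.prod measurableSet_strip)
  exact hs.trans_lt hp.1.1

lemma tendsto_lintegral_lintegral_localize {F : ℝ → ℝ × ℝ → ℝ} (hF : ∀ t z, 0 ≤ F t z)
    (hc : ContinuousOn (fun p : ℝ × ℝ × ℝ => F p.1 p.2) posTime) {s t : ℝ} (hs : 0 ≤ s) :
    Tendsto (fun n : ℕ => ∫⁻ τ in Ioc s t, ∫⁻ z in strip, localize (n + 1) (F τ) z) atTop
      (𝓝 (∫⁻ τ in Ioc s t, ∫⁻ z in strip, ENNReal.ofReal (F τ z))) := by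
  refine lintegral_tendsto_of_tendsto_of_monotone (fun n => ?_)
    (Eventually.of_forall fun τ m n hmn => lintegral_mono fun z => monotone_localize (hF τ) z hmn)
    ?_
  · refine AEMeasurable.lintegral_prod_right' (f := fun p => localize (n + 1) (F p.1) p.2) ?_
    have h1 : AEMeasurable (fun p : ℝ × ℝ × ℝ =>
        ENNReal.ofReal (cutoff (n + 1) p.2.1 * F p.1 p.2))
        ((volume.restrict (Ioc s t)).prod (volume.restrict strip)) := by
      refine (aemeasurable_prod_strip (ContinuousOn.mul ?_ hc) hs).ennreal_ofReal
      exact ((contDiff_cutoff _).continuous.comp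
        (continuous_fst.comp continuous_snd)).continuousOn
    exact h1.indicator (measurable_snd (measurableSet_box (n + 1)))
  · filter_upwards [ae_restrict_mem measurableSet_Ioc] with τ hτ
    exact tendsto_lintegral_localize (hF τ)
      (continuous_slice hc (hs.trans_lt hτ.1)).aemeasurable

lemma lintegral_box_le_strip (L : ℝ) (F : ℝ × ℝ → ℝ≥0∞) :
    ∫⁻ z in box L, F z ≤ ∫⁻ z in strip, F z := lintegral_mono_set (box_subset_strip L)

lemma lintegral_localize_le_box (L : ℝ) {F : ℝ × ℝ → ℝ} (hF : ∀ z, 0 ≤ F z) :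
    ∫⁻ z in strip, localize L F z ≤ ∫⁻ z in box L, ENNReal.ofReal (F z) := by
  rw [lintegral_localize]
  refine setLIntegral_mono' (measurableSet_box L) fun z hz => ENNReal.ofReal_le_ofReal ?_
  exact mul_le_of_le_one_left (hF z) (cutoff_le_one (mem_box.1 hz).1)

/-- The localized energy inequality. -/
lemma StripSolution.energy_localize (h : StripSolution u₁ u₂ f₀ f) (hu : StripDrift u₁ u₂)
    {s t M : ℝ} (hs : 0 < s) (hst : s ≤ t) {L : ℝ} (hL : 1 ≤ L)
    (hM : ∀ τ ∈ Ioc 0 t, ∀ z, |u₁ τ z| ≤ M) {b : ℝ≥0}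
    (hb : ∀ τ ∈ Ioc 0 t, ∫⁻ z in box L, ENNReal.ofReal (profile (f τ z)) ≤ b) :
    (∫⁻ z in strip, localize L (fun z => profile (f t z)) z)
        + ∫⁻ τ in Ioc s t, ∫⁻ z in strip, localize L (dissip f τ) z
      ≤ (∫⁻ z in strip, localize L (fun z => profile (f s z)) z)
        + ENNReal.ofReal ((12 + 4 * M) / L * b * t) := by
  have hL0 : 0 < L := by linarith
  have ht : 0 < t := hs.trans_le hst
  have hM0 : 0 ≤ M := (abs_nonneg _).trans (hM t ⟨ht, le_rfl⟩ 0)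
  have cχ : Continuous fun z : ℝ × ℝ => cutoff L z.1 :=
    (contDiff_cutoff L).continuous.comp continuous_fst
  have cχ3 : Continuous fun p : ℝ × ℝ × ℝ => cutoff L p.2.1 :=
    (contDiff_cutoff L).continuous.comp (continuous_fst.comp continuous_snd)
  have cP : ContinuousOn (fun p : ℝ × ℝ × ℝ => cutoff L p.2.1 * dissip f p.1 p.2) posTime :=
    cχ3.continuousOn.mul h.continuousOn_dissip
  have pc : ∀ {r : ℝ}, 0 < r → Continuous fun z => profile (f r z) := fun {r} hr =>
    continuous_profile.comp (h.contDiff r hr).continuous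
  have e1 : ∀ {r : ℝ}, 0 < r → ∫⁻ z in strip, localize L (fun z => profile (f r z)) z
      = ENNReal.ofReal (∫ z in box L, cutoff L z.1 * profile (f r z)) := fun {r} hr => by
    rw [lintegral_localize, ofReal_integral_eq_lintegral_ofReal]
    · exact Continuous.integrableOn_Icc (cχ.mul (pc hr))
    · exact Eventually.of_forall fun z => mul_nonneg (cutoff_nonneg _ _) (profile_nonneg _)
  have nP : ∀ τ z, 0 ≤ cutoff L z.1 * dissip f τ z := fun τ z =>
    mul_nonneg (cutoff_nonneg _ _) (dissip_nonneg _ _ _)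
  have e2 : ∫⁻ τ in Ioc s t, ∫⁻ z in strip, localize L (dissip f τ) z
      = ENNReal.ofReal (∫ τ in Ioc s t, ∫ z in box L, cutoff L z.1 * dissip f τ z) := by
    rw [ofReal_integral_eq_lintegral_ofReal (integrable_prod_box cP hs L).integral_prod_left
      (Eventually.of_forall fun τ => integral_nonneg fun z => nP τ z)]
    refine setLIntegral_congr_fun measurableSet_Ioc fun τ hτ => ?_
    have hτ0 : 0 < τ := hs.trans hτ.1
    simp only
    rw [lintegral_localize, ofReal_integral_eq_lintegral_ofReal]
    · exact Continuous.integrableOn_Icc (cχ.mul (continuous_slice h.continuousOn_dissip hτ0))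
    · exact Eventually.of_forall fun z => nP τ z
  have nJ : ∀ r, 0 ≤ ∫ z in box L, cutoff L z.1 * profile (f r z) := fun r =>
    integral_nonneg fun z => mul_nonneg (cutoff_nonneg _ _) (profile_nonneg _)
  have nPP : 0 ≤ ∫ τ in Ioc s t, ∫ z in box L, cutoff L z.1 * dissip f τ z :=
    integral_nonneg fun τ => integral_nonneg fun z => nP τ z
  rw [e1 ht, e1 hs, e2, ← ENNReal.ofReal_add (nJ t) nPP, ← ENNReal.ofReal_add (nJ s)
    (by positivity), h.energy_identity hu hs hst hL0]
  refine ENNReal.ofReal_le_ofReal (add_le_add_right ?_ _)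
  -- The flux through the cutoff region is at most `|χ''| + |u₁| |χ'| ≤ (12 + 4M) / L` times the
  -- energy in the box.
  have hQ : ∀ τ ∈ Ioc s t, ‖∫ z in box L,
      profile (f τ z) * (cutoff'' L z.1 + u₁ τ z * cutoff' L z.1)‖ ≤ (12 + 4 * M) / L * b := by
    intro τ hτ
    have hτ0 : 0 < τ := hs.trans hτ.1
    have hi : IntegrableOn (fun z => profile (f τ z)) (box L) :=
      Continuous.integrableOn_Icc (pc hτ0)
    have hb' : ∫ z in box L, profile (f τ z) ≤ b := by
      rw [← ENNReal.ofReal_le_ofReal_iff b.coe_nonneg, ofReal_integral_eq_lintegral_ofReal hi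
        (Eventually.of_forall fun z => profile_nonneg _), ENNReal.ofReal_coe_nnreal]
      exact hb τ ⟨hτ0, hτ.2⟩
    calc _ ≤ ∫ z in box L, (12 + 4 * M) / L * profile (f τ z) := by
          refine norm_integral_le_of_norm_le (hi.const_mul _) ?_
          filter_upwards [ae_restrict_mem (measurableSet_box L)] with z hz
          have hz1 := (mem_box.1 hz).1
          rw [norm_mul, Real.norm_eq_abs, Real.norm_eq_abs, abs_of_nonneg (profile_nonneg _),
            mul_comm]
          refine mul_le_mul_of_nonneg_right ?_ (profile_nonneg _)
          calc |cutoff'' L z.1 + u₁ τ z * cutoff' L z.1|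
              ≤ |cutoff'' L z.1| + |u₁ τ z| * |cutoff' L z.1| := by
                rw [← abs_mul]; exact abs_add_le _ _
            _ ≤ 12 / L + M * (4 / L) := by
                gcongr
                · exact abs_cutoff''_le hL hz1
                · exact hM τ ⟨hτ0, hτ.2⟩ z
                · exact abs_cutoff'_le hL hz1
            _ = (12 + 4 * M) / L := by ring
      _ = (12 + 4 * M) / L * ∫ z in box L, profile (f τ z) := integral_const_mul _ _
      _ ≤ (12 + 4 * M) / L * b := by gcongr
  calc _ ≤ ‖∫ τ in Ioc s t, ∫ z in box L,
        profile (f τ z) * (cutoff'' L z.1 + u₁ τ z * cutoff' L z.1)‖ := Real.le_norm_self _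
    _ ≤ (12 + 4 * M) / L * b * volume.real (Ioc s t) :=
        norm_setIntegral_le_of_norm_le_const (by simp) hQ
    _ ≤ (12 + 4 * M) / L * b * t := by
        rw [Real.volume_real_Ioc_of_le hst]
        gcongr
        linarith

/-- The box is covered by `2(n + 1)` cells of unit length. This linear growth is exactly what the
factor `1/L` in the flux error can absorb. -/
lemma StripSolution.lintegral_box_norm_le (h : StripSolution u₁ u₂ f₀ f) {T : ℝ} (hT : 0 < T) :
    ∃ C : ℝ≥0, ∀ t ∈ Ioc 0 T, ∀ n : ℕ, ∫⁻ z in box (n + 1), ‖f t z‖ₑ ≤ 2 * (n + 1) * C := by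
  obtain ⟨C, hC⟩ := h.uloc_bounded T hT
  refine ⟨C, fun t ht n => ?_⟩
  have hsub : ∀ (a : ℝ) (m : ℕ), Icc a (a + (m + 1)) ×ˢ Icc (0 : ℝ) 1
      ⊆ (Icc a (a + m) ×ˢ Icc (0 : ℝ) 1) ∪ (Icc (a + m) (a + m + 1) ×ˢ Icc (0 : ℝ) 1) := by
    rintro a m z ⟨hz1, hz2⟩
    rcases le_total z.1 (a + m) with h' | h'
    · exact Or.inl ⟨⟨hz1.1, h'⟩, hz2⟩
    · exact Or.inr ⟨⟨h', by linarith [hz1.2]⟩, hz2⟩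
  have key : ∀ (a : ℝ) (m : ℕ),
      ∫⁻ z in Icc a (a + m) ×ˢ Icc (0 : ℝ) 1, ‖f t z‖ₑ ≤ m * C := by
    intro a m
    induction m with
    | zero =>
      have : (volume : Measure (ℝ × ℝ)) (Icc a (a + (0 : ℕ)) ×ˢ Icc (0 : ℝ) 1) = 0 := by
        rw [Measure.volume_eq_prod, Measure.prod_prod]; simp
      rw [setLIntegral_measure_zero _ _ this]; exact zero_le
    | succ m ih =>
      push_cast
      refine (lintegral_mono_set (hsub a m)).trans ((lintegral_union_le _ _ _).trans ?_)
      rw [add_mul, one_mul]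
      exact add_le_add ih (hC t ht _)
  have := key (-(n + 1)) (2 * (n + 1))
  have e : box (n + 1) = Icc (-((n : ℝ) + 1)) (-(n + 1) + (2 * (n + 1) : ℕ)) ×ˢ Icc (0 : ℝ) 1 := by
    rw [Icc_prod_Icc, box]
    congr 2
    push_cast; ring
  rw [e]
  refine this.trans (le_of_eq ?_)
  push_cast; ring

lemma ofReal_profile_le (x : ℝ) : ENNReal.ofReal (profile x) ≤ ENNReal.ofReal x := by
  rw [← max_eq_left (a := ENNReal.ofReal x) (b := ENNReal.ofReal 0) (by simp)]
  rw [← ENNReal.ofReal_max]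
  exact ENNReal.ofReal_le_ofReal (profile_le x)

lemma ofReal_profile_le_add (x y : ℝ) :
    ENNReal.ofReal (profile x) ≤ ENNReal.ofReal (profile y) + ‖x - y‖ₑ := by
  rw [← ofReal_norm, Real.norm_eq_abs, ← ENNReal.ofReal_add (profile_nonneg _)
    (abs_nonneg _)]
  refine ENNReal.ofReal_le_ofReal ?_
  linarith [abs_profile_sub_le x y, le_abs_self (profile x - profile y)]

/-- The localized energy inequality, starting from the initial data. -/
lemma StripSolution.energy_localize_initial (h : StripSolution u₁ u₂ f₀ f)
    (hu : StripDrift u₁ u₂) {t M : ℝ} (ht : 0 < t) {L : ℝ} (hL : 1 ≤ L)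
    (hM : ∀ τ ∈ Ioc 0 t, ∀ z, |u₁ τ z| ≤ M) {b : ℝ≥0}
    (hb : ∀ τ ∈ Ioc 0 t, ∫⁻ z in box L, ENNReal.ofReal (profile (f τ z)) ≤ b) :
    ∫⁻ z in strip, localize L (fun z => profile (f t z)) z
      ≤ (∫⁻ z in strip, ENNReal.ofReal (profile (f₀ z)))
        + ENNReal.ofReal ((12 + 4 * M) / L * b * t) := by
  set E₀ := ∫⁻ z in strip, ENNReal.ofReal (profile (f₀ z))
  set c := ENNReal.ofReal ((12 + 4 * M) / L * b * t)
  -- The starting time tends to zero with `L` fixed, since convergence to the data is only local.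
  have hlim : Tendsto (fun s => E₀ + (∫⁻ z in box L, ‖f s z - f₀ z‖ₑ) + c) (𝓝[>] 0)
      (𝓝 (E₀ + 0 + c)) :=
    ((h.initial L (by linarith)).const_add E₀).add_const c
  rw [add_zero] at hlim
  refine ge_of_tendsto hlim ?_
  filter_upwards [Ioc_mem_nhdsGT ht] with s hs
  have h1 := h.energy_localize hu hs.1 hs.2 hL hM hb
  have hm : AEMeasurable (fun z => ENNReal.ofReal (profile (f₀ z))) (volume.restrict (box L)) :=
    (continuous_profile.measurable.comp_aemeasurable
      (h.aemeasurable.mono_set (box_subset_strip L))).ennreal_ofReal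
  calc _ ≤ _ := (le_add_right le_rfl).trans h1
    _ ≤ (∫⁻ z in box L, ENNReal.ofReal (profile (f s z))) + c := by
        refine add_le_add_left ?_ c
        exact lintegral_localize_le_box L fun z => profile_nonneg _
    _ ≤ (∫⁻ z in box L, (ENNReal.ofReal (profile (f₀ z)) + ‖f s z - f₀ z‖ₑ)) + c := by
        gcongr
        exact ofReal_profile_le_add _ _
    _ ≤ E₀ + (∫⁻ z in box L, ‖f s z - f₀ z‖ₑ) + c := by
        rw [lintegral_add_left' hm]
        gcongr
        exact lintegral_box_le_strip L _

/-- First round of a bootstrap: the a priori mass `O(L)` makes the flux error bounded uniformly in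
`L`, which suffices for finiteness of the global energy but not yet for its monotonicity. -/
lemma StripSolution.lintegral_profile_bounded (h : StripSolution u₁ u₂ f₀ f)
    (hu : StripDrift u₁ u₂) (hfin : ∫⁻ z in strip, ENNReal.ofReal (profile (f₀ z)) ≠ ⊤)
    {T : ℝ} (hT : 0 < T) :
    ∃ b : ℝ≥0, ∀ t ∈ Ioc 0 T, ∫⁻ z in strip, ENNReal.ofReal (profile (f t z)) ≤ b := by
  obtain ⟨C, hC⟩ := h.lintegral_box_norm_le hT
  obtain ⟨M, hM⟩ := hu.bounded T hT
  have hM0 : 0 ≤ M := (abs_nonneg _).trans (hM T ⟨hT, le_rfl⟩ 0)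
  set B := (∫⁻ z in strip, ENNReal.ofReal (profile (f₀ z)))
    + ENNReal.ofReal ((12 + 4 * M) * (2 * C) * T)
  have hB : B ≠ ⊤ := by simp [B, hfin]
  refine ⟨B.toNNReal, fun t ht => ?_⟩
  rw [ENNReal.coe_toNNReal hB]
  refine le_of_tendsto (tendsto_lintegral_localize (fun z => profile_nonneg (f t z))
    (continuous_profile.comp (h.contDiff t ht.1).continuous).aemeasurable)
    (Eventually.of_forall fun n => ?_)
  have hn : (0 : ℝ) ≤ n := n.cast_nonneg
  refine (h.energy_localize_initial hu ht.1 (L := n + 1) (by linarith)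
    (fun τ hτ => hM τ ⟨hτ.1, hτ.2.trans ht.2⟩) (b := 2 * (n + 1) * C) (fun τ hτ => ?_)).trans ?_
  · refine le_trans (lintegral_mono fun z => ?_) ((hC τ ⟨hτ.1, hτ.2.trans ht.2⟩ n).trans ?_)
    · refine (ofReal_profile_le _).trans ?_
      rw [← ofReal_norm]
      exact ENNReal.ofReal_le_ofReal (Real.le_norm_self _)
    · push_cast; exact le_rfl
  · refine add_le_add_right (ENNReal.ofReal_le_ofReal ?_) _
    calc (12 + 4 * M) / (n + 1) * ((2 * (n + 1) * C : ℝ≥0) : ℝ) * t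
        = (12 + 4 * M) * (2 * C) * t := by push_cast; field_simp
      _ ≤ (12 + 4 * M) * (2 * C) * T := by gcongr; exact ht.2

lemma tendsto_error (a : ℝ≥0∞) (k b t : ℝ) :
    Tendsto (fun n : ℕ => a + ENNReal.ofReal (k / (n + 1) * b * t)) atTop (𝓝 a) := by
  have h1 : Tendsto (fun n : ℕ => k / ((n : ℝ) + 1) * b * t) atTop (𝓝 0) := by
    have := (tendsto_one_div_add_atTop_nhds_zero_nat (𝕜 := ℝ)).const_mul (k * b * t)
    rw [mul_zero] at this
    refine this.congr fun n => ?_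
    ring
  have := (ENNReal.tendsto_ofReal h1).const_add a
  simpa using this

/-- The energy does not exceed that of the initial data. -/
lemma StripSolution.lintegral_profile_le_initial (h : StripSolution u₁ u₂ f₀ f)
    (hu : StripDrift u₁ u₂) {t : ℝ} (ht : 0 < t) :
    ∫⁻ z in strip, ENNReal.ofReal (profile (f t z))
      ≤ ∫⁻ z in strip, ENNReal.ofReal (profile (f₀ z)) := by
  by_cases hfin : ∫⁻ z in strip, ENNReal.ofReal (profile (f₀ z)) = ⊤
  · rw [hfin]; exact le_top
  obtain ⟨b, hb⟩ := h.lintegral_profile_bounded hu hfin ht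
  obtain ⟨M, hM⟩ := hu.bounded t ht
  -- Second round: the bound `b` no longer depends on `L`, so the flux error is `O(1/L)` and
  -- disappears in the limit.
  refine le_of_tendsto_of_tendsto' (tendsto_lintegral_localize (fun z => profile_nonneg (f t z))
    (continuous_profile.comp (h.contDiff t ht).continuous).aemeasurable)
    (tendsto_error _ (12 + 4 * M) b t) fun n => ?_
  have hn : (0 : ℝ) ≤ n := n.cast_nonneg
  exact h.energy_localize_initial hu ht (by linarith) hM
    fun τ hτ => (lintegral_box_le_strip _ _).trans (hb τ hτ)

/-- The energy inequality between positive times. -/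
lemma StripSolution.energy_inequality (h : StripSolution u₁ u₂ f₀ f) (hu : StripDrift u₁ u₂)
    (hfin : ∫⁻ z in strip, ENNReal.ofReal (profile (f₀ z)) ≠ ⊤) {s t : ℝ} (hs : 0 < s)
    (hst : s ≤ t) :
    (∫⁻ z in strip, ENNReal.ofReal (profile (f t z)))
        + ∫⁻ τ in Ioc s t, ∫⁻ z in strip, ENNReal.ofReal (dissip f τ z)
      ≤ ∫⁻ z in strip, ENNReal.ofReal (profile (f s z)) := by
  have ht : 0 < t := hs.trans_le hst
  obtain ⟨b, hb⟩ := h.lintegral_profile_bounded hu hfin ht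
  obtain ⟨M, hM⟩ := hu.bounded t ht
  refine le_of_tendsto_of_tendsto' ((tendsto_lintegral_localize
    (fun z => profile_nonneg (f t z))
    (continuous_profile.comp (h.contDiff t ht).continuous).aemeasurable).add
    (tendsto_lintegral_lintegral_localize (dissip_nonneg f) h.continuousOn_dissip hs.le))
    (tendsto_error _ (12 + 4 * M) b t) fun n => ?_
  have hn : (0 : ℝ) ≤ n := n.cast_nonneg
  refine (h.energy_localize hu hs hst (by linarith) hM
    fun τ hτ => (lintegral_box_le_strip _ _).trans (hb τ hτ)).trans ?_
  refine add_le_add_left ?_ _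
  exact (lintegral_localize_le_box _ fun z => profile_nonneg _).trans (lintegral_box_le_strip _ _)

/-! ### Affine invariance and monotonicity of the positive part -/

lemma dt_affine (f : ℝ → ℝ × ℝ → ℝ) (a b : ℝ) :
    dt (fun t z => a * f t z + b) = fun t z => a * dt f t z := by
  ext t z; simp [dt]

lemma dx_affine (f : ℝ → ℝ × ℝ → ℝ) (a b : ℝ) :
    dx (fun t z => a * f t z + b) = fun t z => a * dx f t z := by
  ext t z; simp [dx]

lemma dy_affine (f : ℝ → ℝ × ℝ → ℝ) (a b : ℝ) :
    dy (fun t z => a * f t z + b) = fun t z => a * dy f t z := by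
  ext t z; simp [dy]

lemma dx_const_mul (f : ℝ → ℝ × ℝ → ℝ) (a : ℝ) :
    dx (fun t z => a * f t z) = fun t z => a * dx f t z := by
  ext t z; simp [dx]

lemma dy_const_mul (f : ℝ → ℝ × ℝ → ℝ) (a : ℝ) :
    dy (fun t z => a * f t z) = fun t z => a * dy f t z := by
  ext t z; simp [dy]

/-- The equation is linear without zero-order term, and the uniformly local class contains the
constants. Every estimate for the truncation at level zero thereby holds at every level and scale.
-/
lemma StripSolution.affine (h : StripSolution u₁ u₂ f₀ f) (a b : ℝ) :
    StripSolution u₁ u₂ (fun z => a * f₀ z + b) (fun t z => a * f t z + b) where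
  continuousOn := (h.continuousOn.const_mul a).add continuousOn_const
  continuousOn_dt := by rw [dt_affine]; exact h.continuousOn_dt.const_mul a
  continuousOn_dx := by rw [dx_affine]; exact h.continuousOn_dx.const_mul a
  continuousOn_dy := by rw [dy_affine]; exact h.continuousOn_dy.const_mul a
  differentiableAt t ht z := ((h.differentiableAt t ht z).const_mul a).add_const b
  contDiff t ht := (contDiff_const.mul (h.contDiff t ht)).add contDiff_const
  contDiff_dx t ht := by rw [dx_affine]; exact contDiff_const.mul (h.contDiff_dx t ht)
  contDiff_dy t ht := by rw [dy_affine]; exact contDiff_const.mul (h.contDiff_dy t ht)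
  periodic t ht x := by rw [h.periodic t ht]
  periodic_dy t ht x := by rw [dy_affine]; simp only [h.periodic_dy t ht]
  equation t ht z := by
    rw [dt_affine, dx_affine, dy_affine, dx_const_mul, dy_const_mul]
    linear_combination a * h.equation t ht z
  uloc_bounded T hT := by
    obtain ⟨C, hC⟩ := h.uloc_bounded T hT
    refine ⟨‖a‖₊ * C + ‖b‖₊, fun t ht c => ?_⟩
    have hv : (volume : Measure (ℝ × ℝ)) (Icc c (c + 1) ×ˢ Icc (0 : ℝ) 1) = 1 := by
      rw [Measure.volume_eq_prod, Measure.prod_prod]; simp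
    calc ∫⁻ z in Icc c (c + 1) ×ˢ Icc (0 : ℝ) 1, ‖a * f t z + b‖ₑ
        ≤ ∫⁻ z in Icc c (c + 1) ×ˢ Icc (0 : ℝ) 1, (‖a‖ₑ * ‖f t z‖ₑ + ‖b‖ₑ) := by
          refine lintegral_mono fun z => ?_
          rw [← enorm_mul]; exact enorm_add_le _ _
      _ = ‖a‖ₑ * (∫⁻ z in Icc c (c + 1) ×ˢ Icc (0 : ℝ) 1, ‖f t z‖ₑ) + ‖b‖ₑ := by
          rw [lintegral_add_right _ measurable_const, lintegral_const_mul' _ _ enorm_ne_top,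
            lintegral_const, Measure.restrict_apply_univ, hv, mul_one]
      _ ≤ ‖a‖ₑ * C + ‖b‖ₑ := by gcongr; exact hC t ht c
      _ = _ := by push_cast; rfl
  aemeasurable := (h.aemeasurable.const_mul a).add_const b
  initial R hR := by
    have := ENNReal.Tendsto.const_mul (a := ‖a‖ₑ) (h.initial R hR) (Or.inr enorm_ne_top)
    rw [mul_zero] at this
    refine this.congr fun t => ?_
    rw [← lintegral_const_mul' _ _ enorm_ne_top]
    refine lintegral_congr fun z => ?_
    rw [← enorm_mul]; congr 1; ring

/-! ### From the smooth profile to the positive part. -/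

lemma tendsto_profile_scaled (x : ℝ) :
    Tendsto (fun n : ℕ => profile ((n + 1) * x) / (n + 1)) atTop (𝓝 (max x 0)) := by
  have hmax : ∀ n : ℕ, max (((n : ℝ) + 1) * x) 0 = (n + 1) * max x 0 := fun n => by
    rw [mul_max_of_nonneg _ _ (by positivity), mul_zero]
  have h1 : Tendsto (fun n : ℕ => 1 / ((n : ℝ) + 1)) atTop (𝓝 0) :=
    tendsto_one_div_add_atTop_nhds_zero_nat
  have h2 : Tendsto (fun n : ℕ => max x 0
      - 3 * √((1 / ((n : ℝ) + 1)) ^ 2 + 1 / ((n : ℝ) + 1) * max x 0)) atTop (𝓝 (max x 0)) := by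
    have := (((h1.pow 2).add (h1.mul_const (max x 0))).sqrt.const_mul 3).const_sub (max x 0)
    simpa using this
  refine tendsto_of_tendsto_of_tendsto_of_le_of_le h2 tendsto_const_nhds (fun n => ?_)
    (fun n => ?_)
  · have hn : (0 : ℝ) < n + 1 := by positivity
    have e : √((1 / ((n : ℝ) + 1)) ^ 2 + 1 / ((n : ℝ) + 1) * max x 0)
        = rad ((n + 1) * x) / (n + 1) := by
      rw [rad, hmax, eq_div_iff hn.ne', ← Real.sqrt_sq hn.le, ← Real.sqrt_mul' _ (sq_nonneg _),
        Real.sqrt_sq hn.le]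
      congr 1
      field_simp
    have := le_profile ((n + 1) * x)
    rw [hmax] at this
    simp only
    rw [e, le_div_iff₀ hn]
    refine le_trans (le_of_eq ?_) this
    field_simp
  · have hn : (0 : ℝ) < n + 1 := by positivity
    simp only
    rw [div_le_iff₀ hn]
    have := profile_le ((n + 1) * x)
    rw [hmax] at this
    linarith

/-- Fatou's lemma applied to `profile((n + 1) g) / (n + 1)`, which converges pointwise to `g₊`. -/
lemma lintegral_ofReal_le_of_profile {g : ℝ × ℝ → ℝ} (hg : Continuous g) {A : ℝ≥0∞}
    (h : ∀ n : ℕ, ∫⁻ z in strip, ENNReal.ofReal (profile ((n + 1) * g z))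
      ≤ ENNReal.ofReal (n + 1) * A) :
    ∫⁻ z in strip, ENNReal.ofReal (g z) ≤ A := by
  have hc := continuous_profile
  have h1 : ∀ n : ℕ, ∫⁻ z in strip, ENNReal.ofReal (profile ((n + 1) * g z) / (n + 1)) ≤ A := by
    intro n
    have hn : (0 : ℝ) < n + 1 := by positivity
    have e : ∀ z, ENNReal.ofReal (profile ((n + 1) * g z) / (n + 1))
        = (ENNReal.ofReal (n + 1))⁻¹ * ENNReal.ofReal (profile ((n + 1) * g z)) := fun z => by
      rw [← ENNReal.ofReal_inv_of_pos hn, ← ENNReal.ofReal_mul (by positivity)]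
      congr 1; ring
    simp_rw [e]
    rw [lintegral_const_mul' _ _ (by simp [hn])]
    rw [ENNReal.inv_mul_le_iff (by simp [hn]) (by simp)]
    exact h n
  calc ∫⁻ z in strip, ENNReal.ofReal (g z)
      = ∫⁻ z in strip, liminf (fun n : ℕ =>
          ENNReal.ofReal (profile ((n + 1) * g z) / (n + 1))) atTop := by
        refine lintegral_congr fun z => ?_
        rw [(ENNReal.tendsto_ofReal (tendsto_profile_scaled (g z))).liminf_eq, ENNReal.ofReal_max]
        simp
    _ ≤ liminf (fun n : ℕ => ∫⁻ z in strip,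
          ENNReal.ofReal (profile ((n + 1) * g z) / (n + 1))) atTop :=
        lintegral_liminf_le fun n => by fun_prop
    _ ≤ liminf (fun _ : ℕ => A) atTop := liminf_le_liminf (Eventually.of_forall h1)
    _ = A := by simp

lemma lintegral_ofReal_profile_mul_le (g : ℝ × ℝ → ℝ) (n : ℕ) :
    ∫⁻ z in strip, ENNReal.ofReal (profile ((n + 1) * g z))
      ≤ ENNReal.ofReal (n + 1) * ∫⁻ z in strip, ENNReal.ofReal (g z) := by
  rw [← lintegral_const_mul' _ _ ENNReal.ofReal_ne_top]
  refine lintegral_mono fun z => (ofReal_profile_le _).trans ?_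
  rw [ENNReal.ofReal_mul (by positivity)]

/-- The mass of the positive part does not exceed that of the initial data. -/
lemma StripSolution.lintegral_ofReal_le_initial (h : StripSolution u₁ u₂ f₀ f)
    (hu : StripDrift u₁ u₂) {t : ℝ} (ht : 0 < t) :
    ∫⁻ z in strip, ENNReal.ofReal (f t z) ≤ ∫⁻ z in strip, ENNReal.ofReal (f₀ z) := by
  refine lintegral_ofReal_le_of_profile (h.contDiff t ht).continuous fun n => ?_
  have := (h.affine (n + 1) 0).lintegral_profile_le_initial hu ht
  simp only [add_zero] at this
  exact this.trans (lintegral_ofReal_profile_mul_le f₀ n)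

/-- The mass of the positive part is nonincreasing. -/
lemma StripSolution.lintegral_ofReal_antitone (h : StripSolution u₁ u₂ f₀ f)
    (hu : StripDrift u₁ u₂) (hfin : ∫⁻ z in strip, ENNReal.ofReal (f₀ z) ≠ ⊤) {s t : ℝ}
    (hs : 0 < s) (hst : s ≤ t) :
    ∫⁻ z in strip, ENNReal.ofReal (f t z) ≤ ∫⁻ z in strip, ENNReal.ofReal (f s z) := by
  refine lintegral_ofReal_le_of_profile (h.contDiff t (hs.trans_le hst)).continuous fun n => ?_
  have h2 : ∫⁻ z in strip, ENNReal.ofReal (profile ((n + 1) * f₀ z + 0)) ≠ ⊤ := by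
    simp only [add_zero]
    exact ((lintegral_ofReal_profile_mul_le f₀ n).trans_lt
      (ENNReal.mul_lt_top ENNReal.ofReal_lt_top hfin.lt_top)).ne
  have := (le_add_right le_rfl).trans ((h.affine (n + 1) 0).energy_inequality hu h2 hs hst)
  simp only [add_zero] at this
  exact this.trans (lintegral_ofReal_profile_mul_le (f s) n)

/-! ### A Gagliardo–Nirenberg inequality on the strip -/

/-- Average `|φ(x)| ≤ |φ(y)| + ∫|φ'|` over `y` in the interval. -/
lemma enorm_le_average_add_lintegral_deriv {φ φ' : ℝ → ℝ} {a b x : ℝ} (hab : a < b)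
    (hd : ∀ y, HasDerivAt φ (φ' y) y) (hc : Continuous φ') (hx : x ∈ Icc a b) :
    ‖φ x‖ₑ ≤ (ENNReal.ofReal (b - a))⁻¹ * (∫⁻ y in Icc a b, ‖φ y‖ₑ)
      + ∫⁻ y in Icc a b, ‖φ' y‖ₑ := by
  set I := ∫⁻ y in Icc a b, ‖φ' y‖ₑ
  have h1 : ∀ y ∈ Icc a b, ‖φ x‖ₑ ≤ ‖φ y‖ₑ + I := by
    intro y hy
    have e : φ x = φ y + ∫ z in y..x, φ' z := by
      rw [intervalIntegral.integral_eq_sub_of_hasDerivAt (fun z _ => hd z)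
        (hc.intervalIntegrable _ _)]
      ring
    rw [e]
    refine (enorm_add_le _ _).trans (add_le_add_right ?_ _)
    have : ‖∫ z in y..x, φ' z‖ₑ = ‖∫ z in uIoc y x, φ' z‖ₑ := by
      rw [← ofReal_norm, ← ofReal_norm, intervalIntegral.norm_intervalIntegral_eq]
    rw [this]
    refine (enorm_integral_le_lintegral_enorm _).trans (lintegral_mono_set ?_)
    exact uIoc_subset_uIcc.trans (uIcc_subset_Icc hy hx)
  have hb : ENNReal.ofReal (b - a) ≠ 0 := by simp [hab]
  have h2 : ENNReal.ofReal (b - a) * ‖φ x‖ₑ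
      ≤ (∫⁻ y in Icc a b, ‖φ y‖ₑ) + ENNReal.ofReal (b - a) * I := by
    calc ENNReal.ofReal (b - a) * ‖φ x‖ₑ = ∫⁻ _ in Icc a b, ‖φ x‖ₑ := by
          rw [setLIntegral_const, Real.volume_Icc, mul_comm]
      _ ≤ ∫⁻ y in Icc a b, (‖φ y‖ₑ + I) := setLIntegral_mono' measurableSet_Icc h1
      _ = _ := by
          rw [lintegral_add_right _ measurable_const, setLIntegral_const, Real.volume_Icc,
            mul_comm I]
  calc ‖φ x‖ₑ = (ENNReal.ofReal (b - a))⁻¹ * (ENNReal.ofReal (b - a) * ‖φ x‖ₑ) := by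
        rw [← mul_assoc, ENNReal.inv_mul_cancel hb ENNReal.ofReal_ne_top, one_mul]
    _ ≤ (ENNReal.ofReal (b - a))⁻¹ * ((∫⁻ y in Icc a b, ‖φ y‖ₑ) + ENNReal.ofReal (b - a) * I) := by
        gcongr
    _ = _ := by
        rw [mul_add, ← mul_assoc, ENNReal.inv_mul_cancel hb ENNReal.ofReal_ne_top, one_mul]

lemma restrict_box (L : ℝ) : (volume : Measure (ℝ × ℝ)).restrict (box L)
    = (volume.restrict (Icc (-L) L)).prod (volume.restrict (Icc (0 : ℝ) 1)) := by
  rw [Measure.prod_restrict, Icc_prod_Icc, ← Measure.volume_eq_prod, box]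

/-- Bounding `|g|` along vertical lines gives a function `P` of `x₁` alone, along horizontal lines a
function `Q` of `x₂` alone; the integral of `P(x₁) Q(x₂)` factorizes. -/
lemma lintegral_box_sq_le {g gx gy : ℝ × ℝ → ℝ} (hg : Continuous g) (hgx : Continuous gx)
    (hgy : Continuous gy) (dgx : ∀ z, HasDerivAt (fun s => g (s, z.2)) (gx z) z.1)
    (dgy : ∀ z, HasDerivAt (fun s => g (z.1, s)) (gy z) z.2) {L : ℝ} (hL : 0 < L) :
    ∫⁻ z in box L, ‖g z‖ₑ ^ 2 ≤
      ((∫⁻ z in strip, ‖g z‖ₑ) + ∫⁻ z in strip, ‖gy z‖ₑ)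
      * ((ENNReal.ofReal (2 * L))⁻¹ * (∫⁻ z in strip, ‖g z‖ₑ) + ∫⁻ z in strip, ‖gx z‖ₑ) := by
  set μ := (volume : Measure ℝ).restrict (Icc (-L) L)
  set ν := (volume : Measure ℝ).restrict (Icc (0 : ℝ) 1)
  set P : ℝ → ℝ≥0∞ := fun x => (∫⁻ y, ‖g (x, y)‖ₑ ∂ν) + ∫⁻ y, ‖gy (x, y)‖ₑ ∂ν
  set Q : ℝ → ℝ≥0∞ := fun y =>
    (ENNReal.ofReal (2 * L))⁻¹ * (∫⁻ x, ‖g (x, y)‖ₑ ∂μ) + ∫⁻ x, ‖gx (x, y)‖ₑ ∂μ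
  have mg : Measurable fun z => ‖g z‖ₑ := hg.measurable.enorm
  have mgx : Measurable fun z => ‖gx z‖ₑ := hgx.measurable.enorm
  have mgy : Measurable fun z => ‖gy z‖ₑ := hgy.measurable.enorm
  have mP : Measurable P := mg.lintegral_prod_right'.add mgy.lintegral_prod_right'
  have mQ : Measurable Q := (mg.lintegral_prod_left'.const_mul _).add mgx.lintegral_prod_left'
  have hpt : ∀ z ∈ box L, ‖g z‖ₑ ^ 2 ≤ P z.1 * Q z.2 := by
    intro z hz
    obtain ⟨hz1, hz2⟩ := mem_box.1 hz
    rw [sq]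
    refine mul_le_mul' ?_ ?_
    · have := enorm_le_average_add_lintegral_deriv (φ := fun s => g (z.1, s))
        (φ' := fun s => gy (z.1, s)) zero_lt_one (fun s => dgy (z.1, s)) (by fun_prop) hz2
      simpa [P] using this
    · have := enorm_le_average_add_lintegral_deriv (φ := fun s => g (s, z.2))
        (φ' := fun s => gx (s, z.2)) (a := -L) (b := L) (by linarith)
        (fun s => dgx (s, z.2)) (by fun_prop) (abs_le.1 hz1)
      rw [show L - -L = 2 * L by ring] at this
      exact this
  have hP : ∫⁻ x, P x ∂μ = (∫⁻ z in box L, ‖g z‖ₑ) + ∫⁻ z in box L, ‖gy z‖ₑ := by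
    rw [restrict_box, lintegral_prod _ mg.aemeasurable, lintegral_prod _ mgy.aemeasurable,
      ← lintegral_add_left mg.lintegral_prod_right']
  have hQ : ∫⁻ y, Q y ∂ν = (ENNReal.ofReal (2 * L))⁻¹ * (∫⁻ z in box L, ‖g z‖ₑ)
      + ∫⁻ z in box L, ‖gx z‖ₑ := by
    rw [restrict_box, lintegral_prod_symm _ mg.aemeasurable,
      lintegral_prod_symm _ mgx.aemeasurable,
      ← lintegral_const_mul _ mg.lintegral_prod_left',
      ← lintegral_add_left (mg.lintegral_prod_left'.const_mul _)]
  calc ∫⁻ z in box L, ‖g z‖ₑ ^ 2 ≤ ∫⁻ z in box L, P z.1 * Q z.2 :=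
        setLIntegral_mono' (measurableSet_box L) hpt
    _ = (∫⁻ x, P x ∂μ) * ∫⁻ y, Q y ∂ν := by
        rw [restrict_box, lintegral_prod_mul mP.aemeasurable mQ.aemeasurable]
    _ ≤ _ := by
        rw [hP, hQ]
        gcongr ?_ * (_ * ?_ + ?_)
        · exact add_le_add (lintegral_box_le_strip _ _) (lintegral_box_le_strip _ _)
        · exact lintegral_box_le_strip _ _
        · exact lintegral_box_le_strip _ _

/-- A Gagliardo–Nirenberg inequality on the strip. -/
lemma lintegral_strip_sq_le {g gx gy : ℝ × ℝ → ℝ} (hg : Continuous g) (hgx : Continuous gx)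
    (hgy : Continuous gy) (dgx : ∀ z, HasDerivAt (fun s => g (s, z.2)) (gx z) z.1)
    (dgy : ∀ z, HasDerivAt (fun s => g (z.1, s)) (gy z) z.2) {A B : ℝ≥0∞} (hAfin : A ≠ ⊤)
    (hA : ∫⁻ z in strip, ‖g z‖ₑ ≤ A) (hBx : ∫⁻ z in strip, ‖gx z‖ₑ ≤ B)
    (hBy : ∫⁻ z in strip, ‖gy z‖ₑ ≤ B) :
    ∫⁻ z in strip, ‖g z‖ₑ ^ 2 ≤ (A + B) * B := by
  by_cases hB : B = ⊤
  · simp [hB]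
  have hstrip : strip = ⋃ n : ℕ, box (n + 1) := by
    ext z
    rw [mem_iUnion]
    refine ⟨fun hz => ?_, fun ⟨n, hz⟩ => box_subset_strip _ hz⟩
    obtain ⟨N, hN⟩ := exists_nat_ge |z.1|
    exact ⟨N, mem_box.2 ⟨by linarith, hz.2⟩⟩
  have hmono : Monotone fun n : ℕ => box ((n : ℝ) + 1) := fun m n hmn =>
    box_mono (by gcongr)
  -- Only the horizontal average vanishes as the box grows. The vertical one, over a period of
  -- length one, remains as the summand `A`.
  have hlim : Tendsto (fun n : ℕ => (A + B) * ((ENNReal.ofReal (2 * (n + 1)))⁻¹ * A + B)) atTop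
      (𝓝 ((A + B) * B)) := by
    refine ENNReal.Tendsto.const_mul ?_ (Or.inr (by simp [hAfin, hB]))
    have h1 : Tendsto (fun n : ℕ => ENNReal.ofReal (2 * ((n : ℝ) + 1))) atTop (𝓝 ⊤) := by
      refine ENNReal.tendsto_ofReal_atTop.comp ?_
      exact (tendsto_atTop_add_const_right _ _ tendsto_natCast_atTop_atTop).const_mul_atTop
        two_pos
    have h2 := tendsto_inv_iff.2 h1
    rw [ENNReal.inv_top] at h2
    have := (ENNReal.Tendsto.mul_const h2 (Or.inr hAfin)).add_const B
    simpa using this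
  have hlim2 : Tendsto (fun n : ℕ => ∫⁻ z in box (n + 1), ‖g z‖ₑ ^ 2) atTop
      (𝓝 (∫⁻ z in strip, ‖g z‖ₑ ^ 2)) := by
    rw [hstrip, setLIntegral_iUnion_of_directed _ hmono.directed_le]
    exact tendsto_atTop_iSup fun m n hmn => lintegral_mono_set (hmono hmn)
  refine le_of_tendsto_of_tendsto' hlim2 hlim fun n => ?_
  refine (lintegral_box_sq_le hg hgx hgy dgx dgy (by positivity)).trans ?_
  gcongr

/-! ### De Giorgi iteration -/

lemma ofReal_eq_ofReal_max (x : ℝ) : ENNReal.ofReal x = ENNReal.ofReal (max x 0) := by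
  rw [ENNReal.ofReal_max]; simp

lemma enorm_le_rpow_mul_rpow {g a b : ℝ} (hb : 0 ≤ b) (h : g ^ 2 ≤ max a 0 * b) :
    ‖g‖ₑ ≤ ENNReal.ofReal a ^ (1 / 2 : ℝ) * ENNReal.ofReal b ^ (1 / 2 : ℝ) := by
  rw [← ENNReal.mul_rpow_of_nonneg _ _ (by norm_num), ofReal_eq_ofReal_max a,
    ← ENNReal.ofReal_mul (le_max_right _ _), ENNReal.ofReal_rpow_of_nonneg
      (mul_nonneg (le_max_right _ _) hb) (by norm_num), ← ofReal_norm,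
    ← Real.sqrt_eq_rpow]
  exact ENNReal.ofReal_le_ofReal (Real.abs_le_sqrt h)

/-- Weighted arithmetic–geometric mean: `m d = (c' m)(c d) ≤ (c' m + c d)²`. -/
lemma rpow_half_mul_le {c c' m d : ℝ≥0∞} (hc : c' * c = 1) :
    m ^ (1 / 2 : ℝ) * d ^ (1 / 2 : ℝ) ≤ c' * m + c * d := by
  rw [← ENNReal.mul_rpow_of_nonneg _ _ (by norm_num)]
  calc (m * d) ^ (1 / 2 : ℝ) = ((c' * m) * (c * d)) ^ (1 / 2 : ℝ) := by
        rw [show (c' * m) * (c * d) = (c' * c) * (m * d) by ring, hc, one_mul]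
    _ ≤ ((c' * m + c * d) ^ (2 : ℝ)) ^ (1 / 2 : ℝ) := by
        gcongr
        rw [ENNReal.rpow_two, sq]
        gcongr
        · exact le_self_add
        · exact le_add_self
    _ = c' * m + c * d := by rw [← ENNReal.rpow_mul]; norm_num

lemma ofReal_sub_one_le (x : ℝ) : ENNReal.ofReal (x - 1) ≤ 151 * ‖rootProfile x‖ₑ ^ 2 := by
  rw [ofReal_eq_ofReal_max, ← ofReal_norm, Real.norm_eq_abs, abs_of_nonneg (rootProfile_nonneg x),
    ← ENNReal.ofReal_pow (rootProfile_nonneg x), show (151 : ℝ≥0∞) = ENNReal.ofReal 151 by simp,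
    ← ENNReal.ofReal_mul (by norm_num)]
  exact ENNReal.ofReal_le_ofReal (max_sub_one_le x)

/-- The Gagliardo–Nirenberg inequality for `g = rootProfile ∘ f`, with `∫|g| ≤ m` and both `∫|∂ᵢg|`
at most the square root of `m` times the dissipation. -/
lemma StripSolution.lintegral_ofReal_sub_one_le (h : StripSolution u₁ u₂ f₀ f) {t : ℝ}
    (ht : 0 < t) {m : ℝ≥0∞} (hm : ∫⁻ z in strip, ENNReal.ofReal (f t z) ≤ m) (hmfin : m ≠ ⊤) :
    ∫⁻ z in strip, ENNReal.ofReal (f t z - 1) ≤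
      151 * ((m + m ^ (1 / 2 : ℝ) * (∫⁻ z in strip, ENNReal.ofReal (dissip f t z)) ^ (1 / 2 : ℝ))
        * (m ^ (1 / 2 : ℝ) * (∫⁻ z in strip, ENNReal.ofReal (dissip f t z)) ^ (1 / 2 : ℝ))) := by
  have hf := h.contDiff t ht
  have cf := hf.continuous
  have cd := continuous_slice h.continuousOn_dissip ht
  have c1 := continuous_rootProfile
  have c2 := continuous_rootProfile'
  have cx := (h.contDiff_dx t ht).continuous
  have cy := (h.contDiff_dy t ht).continuous
  have hB : ∀ g : ℝ × ℝ → ℝ, (∀ z, g z ^ 2 ≤ dx f t z ^ 2 + dy f t z ^ 2) →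
      ∫⁻ z in strip, ‖rootProfile' (f t z) * g z‖ₑ
        ≤ m ^ (1 / 2 : ℝ)
          * (∫⁻ z in strip, ENNReal.ofReal (dissip f t z)) ^ (1 / 2 : ℝ) := by
    intro g hg
    calc ∫⁻ z in strip, ‖rootProfile' (f t z) * g z‖ₑ
        ≤ ∫⁻ z in strip, ENNReal.ofReal (f t z) ^ (1 / 2 : ℝ)
            * ENNReal.ofReal (dissip f t z) ^ (1 / 2 : ℝ) := by
          refine lintegral_mono fun z => enorm_le_rpow_mul_rpow (dissip_nonneg _ _ _) ?_
          rw [mul_pow, dissip, ← mul_assoc]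
          exact mul_le_mul (rootProfile'_sq_le _) (hg z) (sq_nonneg _)
            (mul_nonneg (le_max_right _ _) (profile''_nonneg _))
      _ ≤ (∫⁻ z in strip, ENNReal.ofReal (f t z)) ^ (1 / 2 : ℝ)
            * (∫⁻ z in strip, ENNReal.ofReal (dissip f t z)) ^ (1 / 2 : ℝ) := by
          refine ENNReal.lintegral_mul_norm_pow_le ?_ ?_ (by norm_num) (by norm_num)
            (by norm_num)
          · exact cf.measurable.ennreal_ofReal.aemeasurable
          · exact cd.measurable.ennreal_ofReal.aemeasurable
      _ ≤ _ := by gcongr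
  have key := lintegral_strip_sq_le (g := fun z => rootProfile (f t z))
    (gx := fun z => rootProfile' (f t z) * dx f t z)
    (gy := fun z => rootProfile' (f t z) * dy f t z)
    (by fun_prop) (by fun_prop) (by fun_prop)
    (fun z => (hasDerivAt_rootProfile _).comp z.1 (hasDerivAt_dx hf z))
    (fun z => (hasDerivAt_rootProfile _).comp z.2 (hasDerivAt_dy hf z))
    hmfin (le_trans (lintegral_mono fun z => ?_) hm)
    (hB _ fun z => by linarith [sq_nonneg (dy f t z)])
    (hB _ fun z => by linarith [sq_nonneg (dx f t z)])
  · refine le_trans (lintegral_mono fun z => ofReal_sub_one_le (f t z)) ?_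
    rw [lintegral_const_mul' _ _ (by simp)]
    gcongr
  · rw [ofReal_eq_ofReal_max, ← ofReal_norm, Real.norm_eq_abs,
      abs_of_nonneg (rootProfile_nonneg _)]
    exact ENNReal.ofReal_le_ofReal (rootProfile_le _)

lemma V_pos {t : ℝ} (ht : 0 < t) : 0 < V t := lt_min ht (Real.sqrt_pos.2 ht)

/-- A gain of integrability at the expense of raising the level by one. -/
lemma StripSolution.level_gain_one (h : StripSolution u₁ u₂ f₀ f) (hu : StripDrift u₁ u₂)
    (hfin : ∫⁻ z in strip, ENNReal.ofReal (f₀ z) ≠ ⊤) {s t : ℝ} (hs : 0 < s) (hst : s < t) :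
    ∫⁻ z in strip, ENNReal.ofReal (f t z - 1)
      ≤ ENNReal.ofReal (453 / V (t - s)) * (∫⁻ z in strip, ENNReal.ofReal (f s z)) ^ 2 := by
  set m := ∫⁻ z in strip, ENNReal.ofReal (f s z) with hm
  set T := t - s with hT
  have hT0 : 0 < T := sub_pos.2 hst
  have hmfin : m ≠ ⊤ := ((h.lintegral_ofReal_le_initial hu hs).trans_lt hfin.lt_top).ne
  set d : ℝ → ℝ≥0∞ := fun τ => ∫⁻ z in strip, ENNReal.ofReal (dissip f τ z) with hd
  -- The total dissipation on `(s, t]` is paid for by the mass at time `s`.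
  have hD : ∫⁻ τ in Ioc s t, d τ ≤ m := by
    have h2 : ∫⁻ z in strip, ENNReal.ofReal (profile (f₀ z)) ≠ ⊤ :=
      ((lintegral_mono fun z => ofReal_profile_le (f₀ z)).trans_lt hfin.lt_top).ne
    exact (le_add_self.trans (h.energy_inequality hu h2 hs hst.le)).trans
      (lintegral_mono fun z => ofReal_profile_le _)
  set c := ENNReal.ofReal (√T)
  set c' := ENNReal.ofReal (1 / √T)
  have hsT : 0 < √T := Real.sqrt_pos.2 hT0
  have hcc : c' * c = 1 := by
    rw [← ENNReal.ofReal_mul (by positivity), one_div, inv_mul_cancel₀ hsT.ne',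
      ENNReal.ofReal_one]
  have hfin1 : ∫⁻ z in strip, ENNReal.ofReal (1 * f₀ z + -1) ≠ ⊤ := by
    refine ((lintegral_mono fun z => ENNReal.ofReal_le_ofReal ?_).trans_lt hfin.lt_top).ne
    simp
  -- The mass above level one decreases in time, so its value at `t` is bounded by the one at each
  -- earlier `τ`; the estimate can then be averaged over `τ`, where the dissipation is integrable.
  -- The weights `1/√T` and `√T` balance the two resulting terms.
  have hpt : ∀ τ ∈ Ioc s t, ∫⁻ z in strip, ENNReal.ofReal (f t z - 1)
      ≤ 151 * m * (c' * m) + 151 * m * (c + 1) * d τ := by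
    intro τ hτ
    have hτ0 : 0 < τ := hs.trans hτ.1
    have h1 := (h.affine 1 (-1)).lintegral_ofReal_antitone hu hfin1 hτ0 hτ.2
    simp only [one_mul, ← sub_eq_add_neg] at h1
    have h2 := h.lintegral_ofReal_sub_one_le hτ0
      (h.lintegral_ofReal_antitone hu hfin hs hτ.1.le) hmfin
    refine (h1.trans h2).trans ?_
    have e : m ^ (1 / 2 : ℝ) * d τ ^ (1 / 2 : ℝ) * (m ^ (1 / 2 : ℝ) * d τ ^ (1 / 2 : ℝ))
        = m * d τ := by
      rw [mul_mul_mul_comm, ← ENNReal.rpow_add_of_nonneg _ _ (by norm_num) (by norm_num),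
        ← ENNReal.rpow_add_of_nonneg _ _ (by norm_num) (by norm_num)]
      norm_num
    rw [add_mul, e]
    calc _ ≤ 151 * (m * (c' * m + c * d τ) + m * d τ) := by
          gcongr
          exact rpow_half_mul_le hcc
      _ = _ := by ring
  have hvol : volume (Ioc s t) = ENNReal.ofReal T := by rw [Real.volume_Ioc]
  have hint : ENNReal.ofReal T * ∫⁻ z in strip, ENNReal.ofReal (f t z - 1)
      ≤ 151 * m * (c' * m) * ENNReal.ofReal T + 151 * m * (c + 1) * m := by
    calc ENNReal.ofReal T * ∫⁻ z in strip, ENNReal.ofReal (f t z - 1)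
        = ∫⁻ _ in Ioc s t, ∫⁻ z in strip, ENNReal.ofReal (f t z - 1) := by
          rw [setLIntegral_const, hvol, mul_comm]
      _ ≤ ∫⁻ τ in Ioc s t, (151 * m * (c' * m) + 151 * m * (c + 1) * d τ) :=
          setLIntegral_mono' measurableSet_Ioc hpt
      _ = 151 * m * (c' * m) * ENNReal.ofReal T
            + 151 * m * (c + 1) * ∫⁻ τ in Ioc s t, d τ := by
          rw [lintegral_add_left measurable_const, setLIntegral_const, hvol,
            lintegral_const_mul']
          exact ENNReal.mul_ne_top (ENNReal.mul_ne_top (by simp) hmfin) (by simp [c])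
      _ ≤ _ := by gcongr
  have hTne : ENNReal.ofReal T ≠ 0 := by simp [hT0]
  rw [← ENNReal.mul_le_mul_iff_right hTne ENNReal.ofReal_ne_top]
  refine hint.trans ?_
  have e1 : 151 * m * (c' * m) * ENNReal.ofReal T + 151 * m * (c + 1) * m
      = ENNReal.ofReal (151 * (2 * √T + 1)) * m ^ 2 := by
    have e2 : c' * ENNReal.ofReal T = c := by
      rw [← ENNReal.ofReal_mul (by positivity)]
      congr 1
      rw [one_div, inv_mul_eq_div, Real.div_sqrt]
    have e3 : ENNReal.ofReal (151 * (2 * √T + 1)) = 151 * (2 * c + 1) := by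
      rw [ENNReal.ofReal_mul (by norm_num), ENNReal.ofReal_add (by positivity) (by norm_num),
        ENNReal.ofReal_mul (by norm_num)]
      simp [c]
    rw [e3]
    calc _ = 151 * m * m * (c' * ENNReal.ofReal T) + 151 * m * (c + 1) * m := by ring
      _ = _ := by rw [e2]; ring
  rw [e1, ← mul_assoc, ← ENNReal.ofReal_mul hT0.le]
  refine mul_le_mul_left (ENNReal.ofReal_le_ofReal ?_) _
  have hV := V_pos hT0
  rw [← mul_div_assoc, le_div_iff₀ hV]
  have h1 : V T ≤ T := min_le_left _ _
  have h2 : V T ≤ √T := min_le_right _ _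
  have h3 : √T * √T = T := Real.mul_self_sqrt hT0.le
  -- After division by `T` the factor is `151 (2/√T + 1/T)`, and both `1/√T` and `1/T` are at most
  -- `1/V(T)`, whence `453 = 3 · 151`.
  nlinarith [mul_le_mul_of_nonneg_left h2 hsT.le]

/-- A gain of integrability at the expense of raising the level. -/
lemma StripSolution.level_gain (h : StripSolution u₁ u₂ f₀ f) (hu : StripDrift u₁ u₂) {k N : ℝ}
    (hN : 0 < N) (hfin : ∫⁻ z in strip, ENNReal.ofReal (f₀ z - k) ≠ ⊤) {s t : ℝ} (hs : 0 < s)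
    (hst : s < t) :
    ∫⁻ z in strip, ENNReal.ofReal (f t z - (k + N))
      ≤ ENNReal.ofReal (453 / (N * V (t - s)))
        * (∫⁻ z in strip, ENNReal.ofReal (f s z - k)) ^ 2 := by
  have e : ∀ g : ℝ × ℝ → ℝ, ∫⁻ z in strip, ENNReal.ofReal (N⁻¹ * g z + -(N⁻¹ * k))
      = ENNReal.ofReal N⁻¹ * ∫⁻ z in strip, ENNReal.ofReal (g z - k) := fun g => by
    rw [← lintegral_const_mul' _ _ ENNReal.ofReal_ne_top]
    refine lintegral_congr fun z => ?_
    rw [← ENNReal.ofReal_mul (by positivity)]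
    congr 1; ring
  have key := (h.affine N⁻¹ (-(N⁻¹ * k))).level_gain_one hu
    (by rw [e]; exact ENNReal.mul_ne_top ENNReal.ofReal_ne_top hfin) hs hst
  rw [e] at key
  have e2 : ∫⁻ z in strip, ENNReal.ofReal (f t z - (k + N))
      = ENNReal.ofReal N * ∫⁻ z in strip, ENNReal.ofReal (N⁻¹ * f t z + -(N⁻¹ * k) - 1) := by
    rw [← lintegral_const_mul' _ _ ENNReal.ofReal_ne_top]
    refine lintegral_congr fun z => ?_
    rw [← ENNReal.ofReal_mul hN.le]
    congr 1; field_simp; ring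
  rw [e2]
  refine (mul_le_mul_right key _).trans (le_of_eq ?_)
  rw [mul_pow, ← ENNReal.ofReal_pow (by positivity), ← mul_assoc, ← mul_assoc,
    ← ENNReal.ofReal_mul hN.le, ← ENNReal.ofReal_mul (by have := V_pos (sub_pos.2 hst); positivity)]
  congr 2
  have := V_pos (sub_pos.2 hst)
  field_simp

lemma mul_V_le {c : ℝ} (hc : 0 ≤ c) (hc1 : c ≤ 1) (t : ℝ) : c * V t ≤ V (c * t) := by
  refine le_min ?_ ?_
  · exact mul_le_mul_of_nonneg_left (min_le_left _ _) hc
  · refine (mul_le_mul_of_nonneg_left (min_le_right _ _) hc).trans ?_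
    rw [Real.sqrt_mul hc]
    refine mul_le_mul_of_nonneg_right ?_ (Real.sqrt_nonneg _)
    exact Real.le_sqrt_of_sq_le (by nlinarith)

/-- Solutions are bounded from above at positive times, in terms of the mass of the initial data
above a level. -/
lemma StripSolution.ae_le_level_add (h : StripSolution u₁ u₂ f₀ f) (hu : StripDrift u₁ u₂)
    {k a t : ℝ} (ha : 0 < a) (hk : ∫⁻ z in strip, ENNReal.ofReal (f₀ z - k) ≤ ENNReal.ofReal a)
    (ht : 0 < t) :
    ∀ᵐ z ∂(volume.restrict strip), f t z ≤ k + 14496 * a / V t := by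
  have hV := V_pos ht
  -- With level step `lam q(n) / 2` and time step `q(n) t / 4`, the quadratic gain gives `453 · 8 a²
  -- q(n)² / (lam V t)`. Equating this with `a q(n)² / 4` forces `14496 = 453 · 32`.
  set lam := 14496 * a / V t with hlam
  have hl : 0 < lam := by positivity
  set q : ℕ → ℝ := fun n => (1 / 2 : ℝ) ^ n with hq
  have hq0 : ∀ n, 0 < q n := fun n => by positivity
  have hq1 : ∀ n, q n ≤ 1 := fun n => pow_le_one₀ (by norm_num) (by norm_num)
  have hqs : ∀ n, q (n + 1) = q n / 2 := fun n => by simp only [hq, pow_succ]; ring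
  -- The times run from `t/2` up to `t`, the levels from `k` up to `k + lam`. The first time is
  -- positive because the gain is available only between positive times.
  set s : ℕ → ℝ := fun n => t * (1 - q (n + 1)) with hsdef
  set κ : ℕ → ℝ := fun n => k + lam * (1 - q n) with hκ
  have hs0 : ∀ n, 0 < s n := fun n => by
    refine mul_pos ht ?_
    have := hq1 n
    rw [hqs]; linarith
  have hst : ∀ n, s n ≤ t := fun n =>
    mul_le_of_le_one_right ht.le (by linarith [hq0 (n + 1)])
  have hanti : ∀ (c : ℝ), k ≤ c → ∀ r r', 0 < r → r ≤ r' →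
      ∫⁻ z in strip, ENNReal.ofReal (f r' z - c) ≤ ∫⁻ z in strip, ENNReal.ofReal (f r z - c) := by
    intro c hc r r' hr hrr
    have hf : ∫⁻ z in strip, ENNReal.ofReal (1 * f₀ z + -c) ≠ ⊤ := by
      refine ((lintegral_mono fun z => ENNReal.ofReal_le_ofReal ?_).trans_lt
        (hk.trans_lt ENNReal.ofReal_lt_top)).ne
      linarith
    have := (h.affine 1 (-c)).lintegral_ofReal_antitone hu hf hr hrr
    simpa only [one_mul, ← sub_eq_add_neg] using this
  have hκk : ∀ n, k ≤ κ n := fun n => by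
    have := mul_nonneg hl.le (sub_nonneg.2 (hq1 n))
    simp only [hκ]; linarith
  -- The decay rate `4⁻ⁿ` reproduces itself: squaring gives `16⁻ⁿ`, and the shrinking level and time
  -- steps cost `2ⁿ` each.
  have hdecay : ∀ n, ∫⁻ z in strip, ENNReal.ofReal (f (s n) z - κ n)
      ≤ ENNReal.ofReal (a * q n ^ 2) := by
    intro n
    induction n with
    | zero =>
      have := (h.affine 1 (-k)).lintegral_ofReal_le_initial hu (hs0 0)
      simp only [one_mul, ← sub_eq_add_neg] at this
      simpa [hκ, hq] using this.trans hk
    | succ n ih =>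
      have hN : 0 < lam * q (n + 1) := mul_pos hl (hq0 _)
      have hfin : ∫⁻ z in strip, ENNReal.ofReal (f₀ z - κ n) ≠ ⊤ := by
        refine ((lintegral_mono fun z => ENNReal.ofReal_le_ofReal ?_).trans_lt
          (hk.trans_lt ENNReal.ofReal_lt_top)).ne
        linarith [hκk n]
      have hss : s (n + 1) - s n = q (n + 2) * t := by
        simp only [hsdef, hqs]; ring
      have hss0 : 0 < s (n + 1) - s n := by rw [hss]; exact mul_pos (hq0 _) ht
      have key := h.level_gain hu hN hfin (hs0 n) (sub_pos.1 hss0)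
      have hκs : κ n + lam * q (n + 1) = κ (n + 1) := by
        simp only [hκ, hqs]; ring
      rw [hκs] at key
      refine key.trans ?_
      calc _ ≤ ENNReal.ofReal (453 / (lam * q (n + 1) * V (s (n + 1) - s n)))
            * ENNReal.ofReal (a * q n ^ 2) ^ 2 := by gcongr
        _ ≤ ENNReal.ofReal (453 / (lam * q (n + 1) * (q (n + 2) * V t)))
            * ENNReal.ofReal (a * q n ^ 2) ^ 2 := by
          have := hq0 (n + 1)
          have := hq0 (n + 2)
          gcongr
          rw [hss]
          exact mul_V_le (hq0 _).le (hq1 _) t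
        _ = ENNReal.ofReal (453 / (lam * q (n + 1) * (q (n + 2) * V t)) * (a * q n ^ 2) ^ 2) := by
          rw [← ENNReal.ofReal_pow (by positivity), ← ENNReal.ofReal_mul]
          have := hq0 (n + 1)
          have := hq0 (n + 2)
          positivity
        _ = ENNReal.ofReal (a * q (n + 1) ^ 2) := by
          congr 1
          have := (hq0 n).ne'
          simp only [hlam, hqs (n + 1), hqs n]
          field_simp
          norm_num
  have hzero : ∫⁻ z in strip, ENNReal.ofReal (f t z - (k + lam)) = 0 := by
    have hlim : Tendsto (fun n => ENNReal.ofReal (a * q n ^ 2)) atTop (𝓝 0) := by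
      have h1 : Tendsto q atTop (𝓝 0) :=
        tendsto_pow_atTop_nhds_zero_of_lt_one (by norm_num) (by norm_num)
      have := ENNReal.tendsto_ofReal ((h1.pow 2).const_mul a)
      simpa using this
    refine le_antisymm (ge_of_tendsto' hlim fun n => ?_) zero_le
    refine le_trans (lintegral_mono fun z => ENNReal.ofReal_le_ofReal ?_)
      ((hanti (κ n) (hκk n) _ _ (hs0 n) (hst n)).trans (hdecay n))
    have := mul_pos hl (hq0 n)
    simp only [hκ]; linarith
  have hm : Measurable fun z => ENNReal.ofReal (f t z - (k + lam)) :=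
    ((h.contDiff t ht).continuous.sub continuous_const).measurable.ennreal_ofReal
  filter_upwards [(lintegral_eq_zero_iff hm).1 hzero] with z hz
  have := ENNReal.ofReal_eq_zero.1 hz
  linarith

/-! ### Estimates in Lebesgue spaces on the strip -/

lemma StripSolution.neg (h : StripSolution u₁ u₂ f₀ f) :
    StripSolution u₁ u₂ (fun z => -f₀ z) (fun t z => -f t z) := by
  simpa using h.affine (-1) 0

/-- Chebyshev's argument: where `x > k`, the factor `(x/k)^(p - 1)` is at least one. -/
lemma ofReal_sub_le_rpow {x k p : ℝ} (hk : 0 < k) (hp : 1 ≤ p) :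
    ENNReal.ofReal (x - k) ≤ ENNReal.ofReal (k ^ (1 - p)) * ‖x‖ₑ ^ p := by
  rcases le_or_gt x k with hx | hx
  · rw [ENNReal.ofReal_of_nonpos (by linarith)]; exact zero_le
  have hx0 : 0 < x := hk.trans hx
  rw [← ofReal_norm, Real.norm_eq_abs, abs_of_pos hx0,
    ENNReal.ofReal_rpow_of_nonneg hx0.le (by linarith), ← ENNReal.ofReal_mul (by positivity)]
  refine ENNReal.ofReal_le_ofReal ?_
  have h1 : 1 ≤ (x / k) ^ (p - 1) :=
    Real.one_le_rpow ((one_le_div hk).2 hx.le) (by linarith)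
  have h2 : k ^ (1 - p) * x ^ p = x * (x / k) ^ (p - 1) := by
    rw [Real.div_rpow hx0.le hk.le, Real.rpow_sub hk, Real.rpow_sub hx0, Real.rpow_sub hk,
      Real.rpow_one, Real.rpow_one]
    have := Real.rpow_pos_of_pos hk p
    field_simp
  rw [h2]
  nlinarith

/-- The level `k = r / v^{1/p}` is the one for which the Chebyshev bound `k^{1-p} r^p` equals `k v`.
With `v = V(t)` the two terms `k` and `14496 k v / V(t)` of the iteration then have the same form
and add up to `14497 k`. -/
lemma lintegral_sub_level_le {p : ℝ≥0∞} (hp : 1 ≤ p) {r v : ℝ} (hr : 0 < r) (hv : 0 < v)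
    (h₀ : eLpNorm f₀ p (volume.restrict strip) ≤ ENNReal.ofReal r) :
    ∫⁻ z in strip, ENNReal.ofReal (f₀ z - r / v ^ (p⁻¹).toReal)
      ≤ ENNReal.ofReal (r / v ^ (p⁻¹).toReal * v) := by
  by_cases hpt : p = ⊤
  · subst hpt
    rw [eLpNorm_exponent_top] at h₀
    refine le_of_eq_of_le (lintegral_eq_zero_of_ae_eq_zero ?_) zero_le
    filter_upwards [enorm_ae_le_eLpNormEssSup f₀ (volume.restrict strip)] with z hz
    have h1 := hz.trans h₀
    rw [← ofReal_norm, ENNReal.ofReal_le_ofReal_iff hr.le] at h1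
    have h2 := (Real.le_norm_self (f₀ z)).trans h1
    simpa using h2
  have hp0 : p ≠ 0 := (zero_lt_one.trans_le hp).ne'
  set P := p.toReal with hP
  have hP1 : 1 ≤ P := by
    have := ENNReal.toReal_mono hpt hp
    simpa using this
  have hP0 : 0 < P := by linarith
  rw [ENNReal.toReal_inv, ← hP]
  set k := r / v ^ P⁻¹ with hk
  have hvP : 0 < v ^ P⁻¹ := by positivity
  have hk0 : 0 < k := by positivity
  have hB : ∫⁻ z in strip, ‖f₀ z‖ₑ ^ P ≤ ENNReal.ofReal (r ^ P) := by
    rw [eLpNorm_eq_lintegral_rpow_enorm_toReal hp0 hpt, ← hP] at h₀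
    rw [← ENNReal.ofReal_rpow_of_nonneg hr.le hP0.le]
    calc _ = ((∫⁻ z in strip, ‖f₀ z‖ₑ ^ P) ^ (1 / P)) ^ P := by
          rw [← ENNReal.rpow_mul, one_div, inv_mul_cancel₀ hP0.ne', ENNReal.rpow_one]
      _ ≤ _ := by gcongr
  calc ∫⁻ z in strip, ENNReal.ofReal (f₀ z - k)
      ≤ ∫⁻ z in strip, ENNReal.ofReal (k ^ (1 - P)) * ‖f₀ z‖ₑ ^ P :=
        lintegral_mono fun z => ofReal_sub_le_rpow hk0 hP1
    _ = ENNReal.ofReal (k ^ (1 - P)) * ∫⁻ z in strip, ‖f₀ z‖ₑ ^ P :=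
        lintegral_const_mul' _ _ ENNReal.ofReal_ne_top
    _ ≤ ENNReal.ofReal (k ^ (1 - P)) * ENNReal.ofReal (r ^ P) := by gcongr
    _ = ENNReal.ofReal (k * v) := by
        rw [← ENNReal.ofReal_mul (by positivity)]
        congr 1
        have e1 : r = k * v ^ P⁻¹ := by rw [hk]; field_simp
        have e2 : r ^ P = k ^ P * v := by
          rw [e1, Real.mul_rpow hk0.le hvP.le, ← Real.rpow_mul hv.le, inv_mul_cancel₀ hP0.ne',
            Real.rpow_one]
        rw [e2, Real.rpow_sub hk0, Real.rpow_one]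
        have := Real.rpow_pos_of_pos hk0 P
        field_simp

lemma StripSolution.ae_le_of_eLpNorm_le (h : StripSolution u₁ u₂ f₀ f) (hu : StripDrift u₁ u₂)
    {p : ℝ≥0∞} (hp : 1 ≤ p) {r t : ℝ} (hr : 0 < r) (ht : 0 < t)
    (h₀ : eLpNorm f₀ p (volume.restrict strip) ≤ ENNReal.ofReal r) :
    ∀ᵐ z ∂(volume.restrict strip), f t z ≤ 14497 / V t ^ (p⁻¹).toReal * r := by
  have hV := V_pos ht
  have hVp : 0 < V t ^ (p⁻¹).toReal := by positivity
  filter_upwards [h.ae_le_level_add hu (by positivity) (lintegral_sub_level_le hp hr hV h₀) ht]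
    with z hz
  refine hz.trans (le_of_eq ?_)
  field_simp
  norm_num

/-- The smoothing estimate from `L^p` to `L^∞` on the strip. -/
lemma StripSolution.eLpNorm_top_le (h : StripSolution u₁ u₂ f₀ f) (hu : StripDrift u₁ u₂)
    {p : ℝ≥0∞} (hp : 1 ≤ p) (h₀ : eLpNorm f₀ p (volume.restrict strip) ≠ ⊤) {t : ℝ}
    (ht : 0 < t) :
    eLpNorm (f t) ⊤ (volume.restrict strip)
      ≤ ENNReal.ofReal (14497 / V t ^ (p⁻¹).toReal) * eLpNorm f₀ p (volume.restrict strip) := by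
  have hV := V_pos ht
  set c := 14497 / V t ^ (p⁻¹).toReal with hc
  have hc0 : 0 ≤ c := by positivity
  set n := (eLpNorm f₀ p (volume.restrict strip)).toReal with hn
  have hnE : ENNReal.ofReal n = eLpNorm f₀ p (volume.restrict strip) := ENNReal.ofReal_toReal h₀
  rw [← hnE, ← ENNReal.ofReal_mul hc0]
  -- The norm of the data may be zero while the iteration needs a positive bound; hence `r`
  -- decreases to the norm.
  have hlim : Tendsto (fun r => ENNReal.ofReal (c * r)) (𝓝[>] n) (𝓝 (ENNReal.ofReal (c * n))) :=
    ((ENNReal.continuous_ofReal.comp (continuous_const.mul continuous_id)).tendsto n).mono_left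
      nhdsWithin_le_nhds
  refine ge_of_tendsto hlim ?_
  filter_upwards [self_mem_nhdsWithin] with r hr
  have hr0 : 0 < r := ENNReal.toReal_nonneg.trans_lt hr
  have hle : eLpNorm f₀ p (volume.restrict strip) ≤ ENNReal.ofReal r := by
    rw [← hnE]; exact ENNReal.ofReal_le_ofReal (le_of_lt hr)
  have hle' : eLpNorm (fun z => -f₀ z) p (volume.restrict strip) ≤ ENNReal.ofReal r := by
    have : eLpNorm (fun z => -f₀ z) p (volume.restrict strip) = _ := eLpNorm_neg f₀ p _
    rwa [this]
  rw [eLpNorm_exponent_top]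
  refine essSup_le_of_ae_le _ ?_
  filter_upwards [h.ae_le_of_eLpNorm_le hu hp hr0 ht hle,
    h.neg.ae_le_of_eLpNorm_le hu hp hr0 ht hle'] with z h1 h2
  rw [← ofReal_norm]
  exact ENNReal.ofReal_le_ofReal (abs_le.2 ⟨by linarith, h1⟩)

/-! ### Contraction in `L^p` by the layer-cake formula, and interpolation. -/

lemma ofReal_rpow_eq_lintegral {p : ℝ} (hp : 1 < p) (x : ℝ) :
    ENNReal.ofReal x ^ p
      = ∫⁻ k in Ioi (0 : ℝ), ENNReal.ofReal (p * (p - 1) * k ^ (p - 2)) * ENNReal.ofReal (x - k) := by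
  rcases le_or_gt x 0 with hx | hx
  · rw [ENNReal.ofReal_of_nonpos hx, ENNReal.zero_rpow_of_pos (by linarith)]
    refine (setLIntegral_eq_zero measurableSet_Ioi fun k hk => ?_).symm
    have hk' : (0 : ℝ) < k := hk
    rw [ENNReal.ofReal_of_nonpos (p := x - k) (by linarith), mul_zero]
    rfl
  have e1 : ∫⁻ k in Ioi (0 : ℝ),
        ENNReal.ofReal (p * (p - 1) * k ^ (p - 2)) * ENNReal.ofReal (x - k)
      = ∫⁻ k in Ioc 0 x, ENNReal.ofReal (p * (p - 1) * (x * k ^ (p - 2) - k ^ (p - 1))) := by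
    rw [← Ioc_union_Ioi_eq_Ioi hx.le, lintegral_union measurableSet_Ioi
      (Ioc_disjoint_Ioi le_rfl)]
    have : ∫⁻ k in Ioi x, ENNReal.ofReal (p * (p - 1) * k ^ (p - 2)) * ENNReal.ofReal (x - k)
        = 0 := by
      refine setLIntegral_eq_zero measurableSet_Ioi fun k hk => ?_
      have hk' : x < k := hk
      rw [ENNReal.ofReal_of_nonpos (p := x - k) (by linarith), mul_zero]
      rfl
    rw [this, add_zero]
    refine setLIntegral_congr_fun measurableSet_Ioc fun k hk => ?_
    have hk0 : 0 < k := hk.1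
    have hp1 : 0 ≤ p - 1 := by linarith
    rw [← ENNReal.ofReal_mul (by positivity)]
    congr 1
    rw [show p - 1 = (p - 2) + 1 by ring, Real.rpow_add hk0, Real.rpow_one]
    ring
  have i1 : IntervalIntegrable (fun k : ℝ => x * k ^ (p - 2)) volume 0 x :=
    (intervalIntegral.intervalIntegrable_rpow' (by linarith)).const_mul x
  have i2 : IntervalIntegrable (fun k : ℝ => k ^ (p - 1)) volume 0 x :=
    intervalIntegral.intervalIntegrable_rpow' (by linarith)
  have i3 := (i1.sub i2).const_mul (p * (p - 1))
  rw [e1, ← ofReal_integral_eq_lintegral_ofReal]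
  · rw [← intervalIntegral.integral_of_le hx.le, intervalIntegral.integral_const_mul,
      intervalIntegral.integral_sub i1 i2, intervalIntegral.integral_const_mul,
      integral_rpow (Or.inl (by linarith)), integral_rpow (Or.inl (by linarith)),
      ENNReal.ofReal_rpow_of_nonneg hx.le (by linarith)]
    congr 1
    rw [Real.zero_rpow (by linarith), Real.zero_rpow (by linarith),
      show p - 2 + 1 = p - 1 by ring, sub_add_cancel, Real.rpow_sub hx, Real.rpow_one]
    have h1 : p - 1 ≠ 0 := by linarith
    have h2 : p ≠ 0 := by linarith
    field_simp
    ring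
  · exact (intervalIntegrable_iff_integrableOn_Ioc_of_le hx.le).1 i3
  · filter_upwards [ae_restrict_mem measurableSet_Ioc] with k hk
    have hk0 : 0 < k := hk.1
    have hp1 : 0 ≤ p - 1 := by linarith
    have : x * k ^ (p - 2) - k ^ (p - 1) = k ^ (p - 2) * (x - k) := by
      rw [show p - 1 = (p - 2) + 1 by ring, Real.rpow_add hk0, Real.rpow_one]
      ring
    rw [this]
    have := sub_nonneg.2 hk.2
    simp only [Pi.zero_apply]
    positivity

/-- The `p`-th power is a superposition of the truncations `(g - k)₊` with nonnegative weights, so a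
bound for the mass above every level carries over to the `L^p` norm. -/
lemma lintegral_ofReal_rpow_eq {p : ℝ} (hp : 1 < p) {g : ℝ × ℝ → ℝ}
    (hg : AEMeasurable g (volume.restrict strip)) :
    ∫⁻ z in strip, ENNReal.ofReal (g z) ^ p
      = ∫⁻ k in Ioi (0 : ℝ), ENNReal.ofReal (p * (p - 1) * k ^ (p - 2))
          * ∫⁻ z in strip, ENNReal.ofReal (g z - k) := by
  simp_rw [ofReal_rpow_eq_lintegral hp]
  rw [lintegral_lintegral_swap]
  · refine lintegral_congr fun k => ?_
    rw [lintegral_const_mul' _ _ ENNReal.ofReal_ne_top]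
  · have h1 : AEMeasurable (fun q : (ℝ × ℝ) × ℝ => g q.1)
        ((volume.restrict strip).prod (volume.restrict (Ioi (0 : ℝ)))) :=
      hg.comp_quasiMeasurePreserving Measure.quasiMeasurePreserving_fst
    refine AEMeasurable.mul ?_ (h1.sub measurable_snd.aemeasurable).ennreal_ofReal
    exact (by fun_prop : Measurable fun q : (ℝ × ℝ) × ℝ =>
      ENNReal.ofReal (p * (p - 1) * q.2 ^ (p - 2))).aemeasurable

lemma StripSolution.lintegral_ofReal_rpow_le (h : StripSolution u₁ u₂ f₀ f)
    (hu : StripDrift u₁ u₂) {p t : ℝ} (hp : 1 ≤ p) (ht : 0 < t) :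
    ∫⁻ z in strip, ENNReal.ofReal (f t z) ^ p ≤ ∫⁻ z in strip, ENNReal.ofReal (f₀ z) ^ p := by
  rcases hp.eq_or_lt with rfl | hp
  · simpa using h.lintegral_ofReal_le_initial hu ht
  rw [lintegral_ofReal_rpow_eq hp (h.contDiff t ht).continuous.aemeasurable,
    lintegral_ofReal_rpow_eq hp h.aemeasurable]
  refine lintegral_mono fun k => mul_le_mul_right ?_ _
  simpa only [one_mul, ← sub_eq_add_neg] using (h.affine 1 (-k)).lintegral_ofReal_le_initial hu ht

lemma enorm_rpow_eq {p : ℝ} (hp : 0 < p) (x : ℝ) :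
    ‖x‖ₑ ^ p = ENNReal.ofReal x ^ p + ENNReal.ofReal (-x) ^ p := by
  rw [← ofReal_norm, Real.norm_eq_abs]
  rcases le_total 0 x with hx | hx
  · rw [abs_of_nonneg hx, ENNReal.ofReal_of_nonpos (p := -x) (by linarith),
      ENNReal.zero_rpow_of_pos hp, add_zero]
  · rw [abs_of_nonpos hx, ENNReal.ofReal_of_nonpos hx, ENNReal.zero_rpow_of_pos hp, zero_add]

lemma StripSolution.lintegral_enorm_rpow_le (h : StripSolution u₁ u₂ f₀ f)
    (hu : StripDrift u₁ u₂) {p t : ℝ} (hp : 1 ≤ p) (ht : 0 < t) :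
    ∫⁻ z in strip, ‖f t z‖ₑ ^ p ≤ ∫⁻ z in strip, ‖f₀ z‖ₑ ^ p := by
  simp_rw [enorm_rpow_eq (zero_lt_one.trans_le hp)]
  rw [lintegral_add_left, lintegral_add_left']
  · exact add_le_add (h.lintegral_ofReal_rpow_le hu hp ht)
      (h.neg.lintegral_ofReal_rpow_le hu hp ht)
  · exact h.aemeasurable.ennreal_ofReal.pow_const p
  · exact (h.contDiff t ht).continuous.measurable.ennreal_ofReal.pow_const p

lemma lintegral_rpow_le_mul_eLpNorm_top {α : Type*} [MeasurableSpace α] {μ : Measure α}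
    {g : α → ℝ} {p q : ℝ} (hp : 0 ≤ p) (hpq : p ≤ q) (hg : AEMeasurable g μ) :
    ∫⁻ z, ‖g z‖ₑ ^ q ∂μ ≤ eLpNorm g ⊤ μ ^ (q - p) * ∫⁻ z, ‖g z‖ₑ ^ p ∂μ := by
  rw [← lintegral_const_mul'' _ (hg.enorm.pow_const p), eLpNorm_exponent_top]
  refine lintegral_mono_ae ?_
  filter_upwards [enorm_ae_le_eLpNormEssSup g μ] with z hz
  calc ‖g z‖ₑ ^ q = ‖g z‖ₑ ^ (q - p) * ‖g z‖ₑ ^ p := by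
        rw [← ENNReal.rpow_add_of_nonneg _ _ (by linarith) hp, sub_add_cancel]
    _ ≤ _ := by
        gcongr

/-- The smoothing estimate from `L^p` to `L^q` on the strip. -/
lemma StripSolution.eLpNorm_le (h : StripSolution u₁ u₂ f₀ f) (hu : StripDrift u₁ u₂)
    {p q : ℝ≥0∞} (hp : 1 ≤ p) (hpq : p ≤ q) (h₀ : eLpNorm f₀ p (volume.restrict strip) ≠ ⊤)
    {t : ℝ} (ht : 0 < t) :
    eLpNorm (f t) q (volume.restrict strip)
      ≤ ENNReal.ofReal (14497 / V t ^ ((p⁻¹).toReal - (q⁻¹).toReal))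
        * eLpNorm f₀ p (volume.restrict strip) := by
  have hV := V_pos ht
  by_cases hqt : q = ⊤
  · subst hqt
    simpa using h.eLpNorm_top_le hu hp h₀ ht
  have hpt : p ≠ ⊤ := (hpq.trans_lt (lt_top_iff_ne_top.2 hqt)).ne
  have hp0 : p ≠ 0 := (zero_lt_one.trans_le hp).ne'
  have hq0 : q ≠ 0 := (zero_lt_one.trans_le (hp.trans hpq)).ne'
  have hS := h.eLpNorm_top_le hu hp h₀ ht
  set N := eLpNorm f₀ p (volume.restrict strip) with hN
  have hNp : ∫⁻ z in strip, ‖f₀ z‖ₑ ^ p.toReal = N ^ p.toReal := by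
    rw [hN, eLpNorm_eq_lintegral_rpow_enorm_toReal hp0 hpt, ← ENNReal.rpow_mul, one_div,
      inv_mul_cancel₀ (ENNReal.toReal_pos hp0 hpt).ne', ENNReal.rpow_one]
  rw [ENNReal.toReal_inv] at hS ⊢
  rw [ENNReal.toReal_inv, eLpNorm_eq_lintegral_rpow_enorm_toReal hq0 hqt]
  set P := p.toReal
  set Q := q.toReal
  have hP1 : 1 ≤ P := by
    have := ENNReal.toReal_mono hpt hp
    simpa using this
  have hPQ : P ≤ Q := ENNReal.toReal_mono hqt hpq
  have hP0 : 0 < P := by linarith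
  have hQ0 : 0 < Q := by linarith
  have hQP : 0 ≤ Q - P := by linarith
  have hθ : 0 ≤ (Q - P) / Q := by positivity
  have hθ1 : (Q - P) / Q ≤ 1 := (div_le_one hQ0).2 (by linarith)
  calc (∫⁻ z in strip, ‖f t z‖ₑ ^ Q) ^ (1 / Q)
      ≤ ((ENNReal.ofReal (14497 / V t ^ P⁻¹) * N) ^ (Q - P) * N ^ P) ^ (1 / Q) := by
        gcongr
        refine (lintegral_rpow_le_mul_eLpNorm_top hP0.le hPQ
          (h.contDiff t ht).continuous.aemeasurable).trans ?_
        gcongr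
        exact (h.lintegral_enorm_rpow_le hu hP1 ht).trans_eq hNp
    _ = ENNReal.ofReal (14497 / V t ^ P⁻¹) ^ ((Q - P) / Q) * N := by
        rw [ENNReal.mul_rpow_of_nonneg _ _ hQP, mul_assoc,
          ← ENNReal.rpow_add_of_nonneg _ _ hQP hP0.le, sub_add_cancel,
          ENNReal.mul_rpow_of_nonneg _ _ (by positivity), ← ENNReal.rpow_mul, ← ENNReal.rpow_mul,
          mul_one_div_cancel hQ0.ne', ENNReal.rpow_one, mul_one_div]
    _ ≤ ENNReal.ofReal (14497 / V t ^ (P⁻¹ - Q⁻¹)) * N := by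
        gcongr
        rw [ENNReal.ofReal_rpow_of_nonneg (by positivity) hθ,
          Real.div_rpow (by norm_num) (by positivity), ← Real.rpow_mul hV.le,
          show P⁻¹ * ((Q - P) / Q) = P⁻¹ - Q⁻¹ by field_simp]
        refine ENNReal.ofReal_le_ofReal ?_
        gcongr
        -- Interpolation produces the constant to the power `1 - P/Q ≤ 1`, so one constant serves
        -- all exponents.
        calc (14497 : ℝ) ^ ((Q - P) / Q) ≤ 14497 ^ (1 : ℝ) :=
              Real.rpow_le_rpow_of_exponent_le (by norm_num) hθ1
          _ = 14497 := Real.rpow_one _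

/-! ### From the cylinder to the strip -/

/-- The covering map from the plane to the cylinder. -/
def cover (z : ℝ × ℝ) : Cylinder := (z.1, (z.2 : UnitAddCircle))

lemma measurePreserving_cover_restrict {s : Set ℝ} :
    MeasurePreserving cover (volume.restrict (s ×ˢ Icc (0 : ℝ) 1))
      (volume.restrict (s ×ˢ (univ : Set UnitAddCircle))) := by
  have h1 := UnitAddCircle.measurePreserving_mk 0
  rw [zero_add] at h1
  have h2 := (MeasurePreserving.id ((volume : Measure ℝ).restrict s)).prod h1
  have e1 : (volume : Measure (ℝ × ℝ)).restrict (s ×ˢ Icc (0 : ℝ) 1)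
      = (volume.restrict s).prod (volume.restrict (Ioc (0 : ℝ) 1)) := by
    rw [Measure.volume_eq_prod, ← Measure.prod_restrict, restrict_Ioc_eq_restrict_Icc]
  have e2 : (volume : Measure Cylinder).restrict (s ×ˢ (univ : Set UnitAddCircle))
      = (volume.restrict s).prod volume := by
    rw [Measure.volume_eq_prod, ← Measure.prod_restrict, Measure.restrict_univ]
  rw [e1, e2]
  exact h2

lemma measurePreserving_cover : MeasurePreserving cover (volume.restrict strip) volume := by
  have := measurePreserving_cover_restrict (s := univ)
  rwa [univ_prod_univ, Measure.restrict_univ] at this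

lemma continuous_of_comp_cover {E : Type*} [TopologicalSpace E] {g : Cylinder → E}
    (hg : Continuous (g ∘ cover)) : Continuous g := by
  have h1 : IsOpenQuotientMap (fun y : ℝ => (y : UnitAddCircle)) :=
    QuotientAddGroup.isOpenQuotientMap_mk
  have h2 : IsOpenQuotientMap cover := IsOpenQuotientMap.id.prodMap h1
  exact h2.isQuotientMap.continuous_iff.2 hg

lemma d1_cover (g : Cylinder → ℝ) (z : ℝ × ℝ) :
    d1 g (cover z) = deriv (fun s => g (cover (s, z.2))) z.1 := by
  have := deriv_comp_const_add (f := fun s => g (cover (s, z.2))) z.1 0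
  rw [add_zero] at this
  exact this

lemma d2_cover (g : Cylinder → ℝ) (z : ℝ × ℝ) :
    d2 g (cover z) = deriv (fun s => g (cover (z.1, s))) z.2 := by
  have := deriv_comp_const_add (f := fun s => g (cover (z.1, s))) z.2 0
  rw [add_zero] at this
  rw [← this]
  simp [d2, cover]

lemma cover_one (x : ℝ) : cover (x, 1) = cover (x, 0) := by
  simp [cover]

lemma cover_add_one (x y : ℝ) : cover (x, y + 1) = cover (x, y) := by
  simp [cover]

lemma contDiff_slice {F : ℝ × ℝ × ℝ → ℝ} {n : ℕ∞} (hF : ContDiffOn ℝ n F posTime) {t : ℝ}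
    (ht : 0 < t) : ContDiff ℝ n fun z => F (t, z) := by
  rw [← contDiffOn_univ]
  exact hF.comp (by fun_prop) fun z _ => ht

lemma IsDrift.stripDrift {u : ℝ → Cylinder → ℝ × ℝ} (hu : IsDrift u) :
    StripDrift (fun t z => (u t (cover z)).1) (fun t z => (u t (cover z)).2) := by
  have s1 : ContDiffOn ℝ 1 (fun p : ℝ × ℝ × ℝ => (u p.1 (cover p.2)).1) posTime :=
    (contDiff_fst.comp_contDiffOn hu.smooth).of_le (by exact_mod_cast le_top)
  have s2 : ContDiffOn ℝ 1 (fun p : ℝ × ℝ × ℝ => (u p.1 (cover p.2)).2) posTime :=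
    (contDiff_snd.comp_contDiffOn hu.smooth).of_le (by exact_mod_cast le_top)
  have c1 : ∀ t, 0 < t → ContDiff ℝ 1 fun z => (u t (cover z)).1 := fun t ht =>
    contDiff_slice (n := 1) s1 ht
  have c2 : ∀ t, 0 < t → ContDiff ℝ 1 fun z => (u t (cover z)).2 := fun t ht =>
    contDiff_slice (n := 1) s2 ht
  refine ⟨c1, c2, s1.continuousOn, fun t ht z => ?_, fun t ht x => by simp only [cover_one],
    fun T hT => ?_⟩
  · have := hu.div_free t ht (cover z)
    rw [d1_cover, d2_cover] at this
    rwa [(hasDerivAt_slice_fst (c1 t ht) z).deriv, (hasDerivAt_slice_snd (c2 t ht) z).deriv] at this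
  · obtain ⟨M, hM⟩ := hu.horizontal_bounded T hT
    exact ⟨M, fun t ht z => hM t ht _⟩

lemma IsSolution.stripSolution {u : ℝ → Cylinder → ℝ × ℝ} {w₀ : Cylinder → ℝ}
    {w : ℝ → Cylinder → ℝ} (hw : IsSolution u w₀ w) (hw₀ : AEMeasurable w₀ volume) :
    StripSolution (fun t z => (u t (cover z)).1) (fun t z => (u t (cover z)).2)
      (fun z => w₀ (cover z)) (fun t z => w t (cover z)) := by
  set f : ℝ → ℝ × ℝ → ℝ := fun t z => w t (cover z) with hf
  have hC1 : ContDiffOn ℝ 1 (fun p : ℝ × ℝ × ℝ => f p.1 p.2) posTime := hw.contDiffOn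
  have hC2 : ∀ t, 0 < t → ContDiff ℝ 2 (f t) := hw.contDiff_space
  set D : ℝ × ℝ × ℝ → ℝ × ℝ × ℝ →L[ℝ] ℝ := fderiv ℝ (fun p : ℝ × ℝ × ℝ => f p.1 p.2)
  have hD : ContinuousOn D posTime := hC1.continuousOn_fderiv_of_isOpen isOpen_posTime le_rfl
  have hFD : ∀ t, 0 < t → ∀ z, HasFDerivAt (fun p : ℝ × ℝ × ℝ => f p.1 p.2) (D (t, z)) (t, z) :=
    fun t ht z => ((hC1.differentiableOn one_ne_zero).differentiableAt
      (isOpen_posTime.mem_nhds (show (t, z) ∈ posTime from ht))).hasFDerivAt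
  have edt : ∀ t, 0 < t → ∀ z, HasDerivAt (fun s => f s z) (D (t, z) (1, 0)) t := by
    intro t ht z
    have h1 : HasDerivAt (fun s : ℝ => (s, z)) ((1 : ℝ), (0 : ℝ × ℝ)) t :=
      (hasDerivAt_id _).prodMk (hasDerivAt_const _ _)
    exact (hFD t ht z).comp_hasDerivAt t h1
  have edx : ∀ t, 0 < t → ∀ z, dx f t z = D (t, z) (0, 1, 0) := by
    intro t ht z
    have h1 : HasDerivAt (fun s : ℝ => (t, s, z.2)) ((0 : ℝ), (1 : ℝ), (0 : ℝ)) z.1 :=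
      (hasDerivAt_const _ _).prodMk ((hasDerivAt_id _).prodMk (hasDerivAt_const _ _))
    have h2 : HasFDerivAt (fun p : ℝ × ℝ × ℝ => f p.1 p.2) (D (t, z))
      ((fun s : ℝ => (t, s, z.2)) z.1) := hFD t ht z
    exact (h2.comp_hasDerivAt z.1 h1).deriv
  have edy : ∀ t, 0 < t → ∀ z, dy f t z = D (t, z) (0, 0, 1) := by
    intro t ht z
    have h1 : HasDerivAt (fun s : ℝ => (t, z.1, s)) ((0 : ℝ), (0 : ℝ), (1 : ℝ)) z.2 :=
      (hasDerivAt_const _ _).prodMk ((hasDerivAt_const _ _).prodMk (hasDerivAt_id _))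
    have h2 : HasFDerivAt (fun p : ℝ × ℝ × ℝ => f p.1 p.2) (D (t, z))
      ((fun s : ℝ => (t, z.1, s)) z.2) := hFD t ht z
    exact (h2.comp_hasDerivAt z.2 h1).deriv
  have hc : ∀ t, 0 < t → ContDiff ℝ 1 (f t) := fun t ht => (hC2 t ht).of_le one_le_two
  have edx' : ∀ t, 0 < t → dx f t = fun z => fderiv ℝ (f t) z (1, 0) := fun t ht => by
    ext z; exact (hasDerivAt_slice_fst (hc t ht) z).deriv
  have edy' : ∀ t, 0 < t → dy f t = fun z => fderiv ℝ (f t) z (0, 1) := fun t ht => by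
    ext z; exact (hasDerivAt_slice_snd (hc t ht) z).deriv
  have hfd : ∀ t, 0 < t → ContDiff ℝ 1 (fderiv ℝ (f t)) := fun t ht =>
    (hC2 t ht).fderiv_right (by norm_num)
  have hwc : ∀ t, 0 < t → Continuous (w t) := fun t ht =>
    continuous_of_comp_cover (hC2 t ht).continuous
  have hd1 : ∀ t, (fun z => d1 (w t) (cover z)) = dx f t := fun t => by
    ext z; exact d1_cover _ z
  have hd2 : ∀ t, (fun z => d2 (w t) (cover z)) = dy f t := fun t => by
    ext z; exact d2_cover _ z
  refine
    { continuousOn := hC1.continuousOn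
      continuousOn_dt := ?_
      continuousOn_dx := ?_
      continuousOn_dy := ?_
      differentiableAt := fun t ht z => (edt t ht z).differentiableAt
      contDiff := hc
      contDiff_dx := fun t ht => ?_
      contDiff_dy := fun t ht => ?_
      periodic := fun t ht x => by simp only [hf, cover_one]
      periodic_dy := fun t ht x => ?_
      equation := fun t ht z => ?_
      uloc_bounded := fun T hT => ?_
      aemeasurable := hw₀.comp_quasiMeasurePreserving measurePreserving_cover.quasiMeasurePreserving
      initial := fun R hR => ?_ }
  · exact (hD.clm_apply (g := fun _ => (1, 0)) continuousOn_const).congr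
      fun p hp => (edt p.1 hp p.2).deriv
  · exact (hD.clm_apply (g := fun _ => (0, 1, 0)) continuousOn_const).congr
      fun p hp => edx p.1 hp p.2
  · exact (hD.clm_apply (g := fun _ => (0, 0, 1)) continuousOn_const).congr
      fun p hp => edy p.1 hp p.2
  · rw [edx' t ht]; exact (hfd t ht).clm_apply contDiff_const
  · rw [edy' t ht]; exact (hfd t ht).clm_apply contDiff_const
  -- The vertical derivative is periodic because the function is invariant under the shift by one.
  · have := deriv_comp_add_const (f := fun s => f t (x, s)) 1 0
    simp only [hf, cover_add_one, zero_add] at this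
    exact this.symm
  · have h1 := hw.equation t ht (cover z)
    have e1 : d1 (w t) (cover z) = dx f t z := congrFun (hd1 t) z
    have e2 : d2 (w t) (cover z) = dy f t z := congrFun (hd2 t) z
    have e3 : d1 (d1 (w t)) (cover z) = dx (dx f) t z := by
      rw [d1_cover, dx]
      simp only [← hd1 t]
    have e4 : d2 (d2 (w t)) (cover z) = dy (dy f) t z := by
      rw [d2_cover, dy]
      simp only [← hd2 t]
    rw [laplacian, e1, e2, e3, e4] at h1
    exact h1
  · obtain ⟨C, hC⟩ := hw.uloc_bounded T hT
    refine ⟨C, fun t ht a => ?_⟩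
    have := measurePreserving_cover_restrict (s := Icc a (a + 1))
    exact (this.lintegral_comp (hwc t ht.1).measurable.enorm).trans_le (hC t ht a)
  · refine (hw.initial R hR).congr' ?_
    filter_upwards [self_mem_nhdsWithin] with t ht
    have := measurePreserving_cover_restrict (s := Icc (-R) R)
    have hm : AEMeasurable (fun x => ‖w t x - w₀ x‖ₑ)
        (volume.restrict (Icc (-R) R ×ˢ (univ : Set UnitAddCircle))) :=
      ((hwc t ht).measurable.aemeasurable.sub hw₀.restrict).enorm
    -- The data are only almost everywhere measurable, so the change of variables goes through the
    -- image measure.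
    rw [← this.map_eq] at hm ⊢
    rw [lintegral_map' hm this.measurable.aemeasurable, Icc_prod_Icc]
    rfl

end CylinderFlow

/-! ### The smoothing estimate on the cylinder. -/

theorem proposition3p3 (p q : ℝ≥0∞) (hp : 1 ≤ p) (hpq : p ≤ q) :
    ∃ K₁ : ℝ, 0 < K₁ ∧
      ∀ u : ℝ → CylinderFlow.Cylinder → ℝ × ℝ, CylinderFlow.IsDrift u →
      ∀ w₀ : CylinderFlow.Cylinder → ℝ, MemLp w₀ p volume →
      ∀ w : ℝ → CylinderFlow.Cylinder → ℝ, CylinderFlow.IsSolution u w₀ w →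
      ∀ t : ℝ, 0 < t →
        eLpNorm (w t) q volume
          ≤ ENNReal.ofReal (K₁ / CylinderFlow.V t ^ ((p⁻¹).toReal - (q⁻¹).toReal))
            * eLpNorm w₀ p volume := by
  refine ⟨14497, by norm_num, fun u hu w₀ hw₀ w hw t ht => ?_⟩
  have hπ := CylinderFlow.measurePreserving_cover
  have hwt : Continuous (w t) :=
    CylinderFlow.continuous_of_comp_cover (hw.contDiff_space t ht).continuous
  have e1 := eLpNorm_comp_measurePreserving (p := q) hwt.aestronglyMeasurable hπ
  have e2 := eLpNorm_comp_measurePreserving (p := p) hw₀.1 hπ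
  rw [← e1, ← e2]
  refine (hw.stripSolution hw₀.1.aemeasurable).eLpNorm_le hu.stripDrift hp hpq ?_ ht
  exact e2.trans_ne hw₀.2.ne
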